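/- **Setting.** A *program* $P$ consists of typed global variables and finitely many functions, each with its own local variables and formal parameters and with a graph of locations having an entry location (no in-edge) and a different exit location (no out-edge); edges stay inside a function. A location has no out-edge, or one out-edge labelled by an assignment, a call by value $x:=f(\ldots)$ or $f(\ldots)$, a statement $\mathtt{ret}\ e$ (which stores $e$ in the global variable $\mathbf{ret}_f$ of its function $f$) or $\mathtt{skip}$, or two out-edges labelled $\gamma$ and $\neg\gamma$. The starting function is never called, and call edges do not touch entry or exit locations. An *error location* is one whose only out-edge is a $\mathtt{skip}$ loop. *Symbolic expressions* are built by operators from constants, symbols $\Theta(a)$ (one for each program variable $a$) and *parameters*, which range over non-negative integers; boolean ones may quantify parameters. A *symbolic memory* maps variables to symbolic expressions. A *state* is $s=(\theta,\varphi,\Xi,l)$: a memory, a path condition, a call stack and a location. Ordinary stack records consist of the values $\sigma$ of the caller's local variables and the return location (with the destination of the returned value). *Composition:* $\theta\langle\!\langle\varphi\rangle\!\rangle$ replaces each symbol $\Theta(a)$ in $\varphi$ by $\theta(a)$; $(\theta\circ\theta')(a)=\theta\langle\!\langle\theta'(a)\rangle\!\rangle$; $(\theta,\varphi,\Xi,l)\circ(\theta',\varphi',\Xi',l')=(\theta\circ\theta',\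 \varphi\wedge\theta\langle\!\langle\varphi'\rangle\!\rangle,\ \Xi\circ(\theta\circ\Xi'),\ l')$, where $\Xi\circ(\theta\circ\Xi')$ puts the records of $\Xi'$, composed with $\theta$, on top of $\Xi$. *Valuation:* $s\langle\nu\rangle$ replaces every parameter by its integer, and every special stack record $(t,\kappa)$ by $\nu(\kappa)$ records $(\bot,\bot)$, where $(\bot,\bot)$ stands for any record. *Equivalence:* $s\equiv s'$ if the locations are equal, the path conditions are logically equivalent, the memories are equal under every assignment, and the stacks have the same length and pairwise equivalent records; $\overset{g}{\equiv}$ is the same with memories compared on global variables only. *Classic tree.* $T$ is the (possibly infinite) tree with root $(\Theta,\mathrm{true},[],\text{entry of the starting function})$ in which a vertex whose location is the exit of the starting function or an error location has no children, and any other vertex $u$ has as children the states obtained from $u.s$ by executing one out-edge of $u.l$ (a call pushes a record), or, at an exit location, by returning to the top record, whose path condition is satisfiable. *Templates* (of $P$, with one parameter $\kappa$). Let $n>0$, let $s_i=(\theta_i,\varphi_i,\Xi_i,l_i)$ ($1\le i\le n$) be states with no parameter but $\kappa$ and only ordinary stack records, with $\varphi_i$ satisfiable, $\varphi_i\wedge\varphi_j\equiv\mathrm{false}$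 for $i\ne j$, and no $l_i$ an entry or exit location. Say that $w$ is *inside* $u$ (for $w$ a successor of $u$ in $T$) if no vertex from $u$ to $w$ has a shorter call stack than $u$, i.e. the activation of $u$ is not left. - $t=(l,n,\{s_1,\dots,s_n\})$ is a *template* if $l$ is neither an entry nor an exit location; for each path in $T$ from a vertex $u$ with $u.l=l$ to a leaf there are a vertex $w\ne u$ on it that is inside $u$, an $i$ and an integer $\nu\ge0$ with $w.s\equiv u.s\circ s_i\langle\nu\rangle$; and for all $u$ with $u.l=l$, $i$, $\nu\ge 0$ with $u.\varphi\wedge u.\theta\langle\!\langle\varphi_i\langle\nu\rangle\rangle\!\rangle$ satisfiable, $u$ has a successor $w$ in $T$ with $w.s\equiv u.s\circ s_i\langle\nu\rangle$. - $t=(l,n,\{s_1,\dots,s_n\},\theta,l')$ ($\theta$ a memory with no parameter but $\kappa$) is a *recursion template* if, with $\hat s_i=(\theta_i,\varphi_i,[(t,\kappa)]\circ\Xi_i,l_i)$: $l$ and $l'$ are the entry and the exit of one function $f$, which is called somewhere in $P$, and the activation directly above the record $(t,\kappa)$ in $\hat s_i$ is one of $f$ (the bottom record of $\Xi_i$ returns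 into $f$, or $\Xi_i=[]$ and $l_i$ is in $f$); for each path in $T$ from a vertex $u$ with $u.l=l$ to a leaf there are a non-leaf vertex $w\ne u$ on it that is inside $u$, an $i$ and a $\nu\ge0$ with $w.s\equiv u.s\circ\hat s_i\langle\nu\rangle$, such that, if $\bar w$ is the first vertex after $w$ on the path with $\bar w.l=l'$ whose stack is that of $w$ without the records of $\Xi_i$, then some non-leaf vertex $\bar u$ of the path, equal to or after $\bar w$ and inside $u$, satisfies $\bar u.s\overset{g}{\equiv}(\bar w.\theta\circ\theta\langle\nu\rangle,\bar w.\varphi,u.\Xi,l')$; and for all $u$ with $u.l=l$, $i$, $\nu\ge0$ with $u.\varphi\wedge u.\theta\langle\!\langle\varphi_i\langle\nu\rangle\rangle\!\rangle$ satisfiable, $u$ has a successor $w$ in $T$ with $w.s\equiv u.s\circ\hat s_i\langle\nu\rangle$. *Compact tree.* Let $p$ be any set of templates and recursion templates of $P$. A compact tree $T'$ is built like $T$, except that the candidate children of a vertex with state $s$, not at the exit of the starting function nor at an error location, are: (a) if the top record is $(t,\kappa)$ and $s.l=t.l'$: the single state $(s.\theta\circ t.\theta\langle\kappa\rangle,s.\varphi,\mathrm{pop}(s.\Xi),t.l')$;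 (b) otherwise, if some template of $p$ has entry location $s.l$: one such $t$ is chosen arbitrarily, its parameter is renamed to a fresh $\kappa$, and the candidates are $s\circ s_i\langle\kappa\rangle$ (respectively $s\circ\hat s_i\langle\kappa\rangle$ for a recursion template), $i=1,\dots,n$; (c) otherwise the classic successors. Candidates with unsatisfiable path condition are dropped. **Theorem (Soundness).** Let $T$ be the classic symbolic execution tree of a program $P$ and $T'$ a compact symbolic execution tree of $P$ built with a set of templates and recursion templates with one parameter. For every leaf $e$ of $T$ there are a leaf $e'$ of $T'$ and a valuation $\nu$ of the parameters of $e'.s$ such that $e.s\equiv e'.s\langle\nu\rangle$. -/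

import Mathlib

namespace CSE

/-! ### Data types, program variables and symbolic expressions -/

/-- The data types with their operators and predicates, and the typed program variables.
Everything is interpreted: operators are functions and predicates are relations on the values.
`num` is the numeric type in which parameters (non-negative integers) are read. -/
structure Vocab where
  Srt : Type
  Val : Srt → Type
  val_nonempty : ∀ s, Nonempty (Val s)
  num : Srt
  ofNat : ℕ → Val num
  Op : Type
  opArity : Op → ℕ
  opArg : (o : Op) → Fin (opArity o) → Srt
  opRes : Op → Srt
  opEval : (o : Op) → ((i : Fin (opArity o)) → Val (opArg o i)) → Val (opRes o)
  Rel : Type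
  relArity : Rel → ℕ
  relArg : (r : Rel) → Fin (relArity r) → Srt
  relEval : (r : Rel) → ((i : Fin (relArity r)) → Val (relArg r i)) → Prop
  Var : Type
  ty : Var → Srt

/-- Symbolic expressions whose free parameters are taken from `K` and which may use `n`
parameters bound by surrounding quantifiers. `sym a` is the symbol `Θ(a)` of the program
variable `a`. `K = Empty`: no parameter; `K = Unit`: one parameter; `K = ℕ`: any parameters.
An expression over program variables is also represented by this type (with `K = Empty`),
`sym a` standing for the variable `a`. -/
inductive SymExpr (V : Vocab) (K : Type) (n : ℕ) : V.Srt → Type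
  | const {s : V.Srt} (c : V.Val s) : SymExpr V K n s
  | sym (a : V.Var) : SymExpr V K n (V.ty a)
  | param (k : K) : SymExpr V K n V.num
  | bound (i : Fin n) : SymExpr V K n V.num
  | op (o : V.Op) (args : (i : Fin (V.opArity o)) → SymExpr V K n (V.opArg o i)) :
      SymExpr V K n (V.opRes o)

/-- Boolean symbolic expressions; quantifiers range over parameters. -/
inductive BoolExpr (V : Vocab) (K : Type) : ℕ → Type
  | tru {n : ℕ} : BoolExpr V K n
  | eq {n : ℕ} {s : V.Srt} (e e' : SymExpr V K n s) : BoolExpr V K n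
  | rel {n : ℕ} (r : V.Rel) (args : (i : Fin (V.relArity r)) → SymExpr V K n (V.relArg r i)) :
      BoolExpr V K n
  | neg {n : ℕ} (φ : BoolExpr V K n) : BoolExpr V K n
  | and {n : ℕ} (φ ψ : BoolExpr V K n) : BoolExpr V K n
  | all {n : ℕ} (φ : BoolExpr V K (n + 1)) : BoolExpr V K n

/-- Symbolic memories. -/
abbrev Mem (V : Vocab) (K : Type) : Type := (a : V.Var) → SymExpr V K 0 (V.ty a)

/-- The initial symbolic memory `Θ`. -/
def Mem.init (V : Vocab) (K : Type) : Mem V K := fun a => .sym a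

namespace SymExpr

variable {V : Vocab} {K K' : Type}

/-- Value under an assignment of the symbols, the parameters and the bound parameters. -/
def eval {n : ℕ} (ρ : (a : V.Var) → V.Val (V.ty a)) (κ : K → ℕ) (b : Fin n → ℕ) :
    {s : V.Srt} → SymExpr V K n s → V.Val s
  | _, const c => c
  | _, sym a => ρ a
  | _, param k => V.ofNat (κ k)
  | _, bound i => V.ofNat (b i)
  | _, op o args => V.opEval o (fun i => (args i).eval ρ κ b)

/-- Renaming of parameters. -/
def rename {n : ℕ} (f : K → K') : {s : V.Srt} → SymExpr V K n s → SymExpr V K' n s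
  | _, const c => const c
  | _, sym a => sym a
  | _, param k => param (f k)
  | _, bound i => bound i
  | _, op o args => op o (fun i => (args i).rename f)

/-- `e⟨ν⟩`: every parameter is replaced by its integer in `ν`. -/
def value {n : ℕ} (ν : K → ℕ) : {s : V.Srt} → SymExpr V K n s → SymExpr V Empty n s
  | _, const c => const c
  | _, sym a => sym a
  | _, param k => const (V.ofNat (ν k))
  | _, bound i => bound i
  | _, op o args => op o (fun i => (args i).value ν)

/-- An expression without bound parameters, placed under `n` quantifiers. -/
def lift (n : ℕ) : {s : V.Srt} → SymExpr V K 0 s → SymExpr V K n s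
  | _, const c => const c
  | _, sym a => sym a
  | _, param k => param k
  | _, bound i => i.elim0
  | _, op o args => op o (fun i => (args i).lift n)

/-- `θ⟪e⟫`: every symbol `Θ(a)` is replaced by `θ(a)`, simultaneously. -/
def subst {n : ℕ} (θ : Mem V K) : {s : V.Srt} → SymExpr V K n s → SymExpr V K n s
  | _, const c => const c
  | _, sym a => (θ a).lift n
  | _, param k => param k
  | _, bound i => bound i
  | _, op o args => op o (fun i => (args i).subst θ)

/-- Equivalence of expressions. -/
def Equiv {s : V.Srt} (e e' : SymExpr V K 0 s) : Prop :=
  ∀ (ρ : (a : V.Var) → V.Val (V.ty a)) (κ : K → ℕ), e.eval ρ κ Fin.elim0 = e'.eval ρ κ Fin.elim0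

end SymExpr

namespace BoolExpr

variable {V : Vocab} {K K' : Type}

def Holds (ρ : (a : V.Var) → V.Val (V.ty a)) (κ : K → ℕ) :
    {n : ℕ} → (Fin n → ℕ) → BoolExpr V K n → Prop
  | _, _, tru => True
  | _, b, eq e e' => e.eval ρ κ b = e'.eval ρ κ b
  | _, b, rel r args => V.relEval r (fun i => (args i).eval ρ κ b)
  | _, b, neg φ => ¬ φ.Holds ρ κ b
  | _, b, and φ ψ => φ.Holds ρ κ b ∧ ψ.Holds ρ κ b
  | _, b, all φ => ∀ m : ℕ, φ.Holds ρ κ (Fin.snoc b m : Fin (_ + 1) → ℕ)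

def rename (f : K → K') : {n : ℕ} → BoolExpr V K n → BoolExpr V K' n
  | _, tru => tru
  | _, eq e e' => eq (e.rename f) (e'.rename f)
  | _, rel r args => rel r (fun i => (args i).rename f)
  | _, neg φ => neg (φ.rename f)
  | _, and φ ψ => and (φ.rename f) (ψ.rename f)
  | _, all φ => all (φ.rename f)

def value (ν : K → ℕ) : {n : ℕ} → BoolExpr V K n → BoolExpr V Empty n
  | _, tru => tru
  | _, eq e e' => eq (e.value ν) (e'.value ν)
  | _, rel r args => rel r (fun i => (args i).value ν)
  | _, neg φ => neg (φ.value ν)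
  | _, and φ ψ => and (φ.value ν) (ψ.value ν)
  | _, all φ => all (φ.value ν)

def subst (θ : Mem V K) : {n : ℕ} → BoolExpr V K n → BoolExpr V K n
  | _, tru => tru
  | _, eq e e' => eq (e.subst θ) (e'.subst θ)
  | _, rel r args => rel r (fun i => (args i).subst θ)
  | _, neg φ => neg (φ.subst θ)
  | _, and φ ψ => and (φ.subst θ) (ψ.subst θ)
  | _, all φ => all (φ.subst θ)

/-- Satisfiability: symbols and free parameters may be chosen. -/
def Sat (φ : BoolExpr V K 0) : Prop :=
  ∃ (ρ : (a : V.Var) → V.Val (V.ty a)) (κ : K → ℕ), φ.Holds ρ κ Fin.elim0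

/-- Logical equivalence. -/
def Equiv (φ ψ : BoolExpr V K 0) : Prop :=
  ∀ (ρ : (a : V.Var) → V.Val (V.ty a)) (κ : K → ℕ),
    φ.Holds ρ κ Fin.elim0 ↔ ψ.Holds ρ κ Fin.elim0

end BoolExpr

namespace Mem

variable {V : Vocab} {K K' : Type}

def rename (f : K → K') (θ : Mem V K) : Mem V K' := fun a => (θ a).rename f

def value (ν : K → ℕ) (θ : Mem V K) : Mem V Empty := fun a => (θ a).value ν

/-- The composition `θ ∘ θ'`. -/
def comp (θ θ' : Mem V K) : Mem V K := fun a => (θ' a).subst θ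

def Equiv (θ θ' : Mem V K) : Prop := ∀ a, (θ a).Equiv (θ' a)

/-- The value in `θ` of an expression over program variables. -/
def exprIn {s : V.Srt} (θ : Mem V K) (e : SymExpr V Empty 0 s) : SymExpr V K 0 s :=
  (e.rename (fun k : Empty => k.elim)).subst θ

/-- The value in `θ` of a boolean expression over program variables. -/
def boolIn (θ : Mem V K) (γ : BoolExpr V Empty 0) : BoolExpr V K 0 :=
  (γ.rename (fun k : Empty => k.elim)).subst θ

open Classical in
noncomputable def set (θ : Mem V K) (x : V.Var) (e : SymExpr V K 0 (V.ty x)) : Mem V K :=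
  Function.update θ x e

open Classical in
/-- Effect of `x := y` for two variables of the same type. -/
noncomputable def copy (θ : Mem V K) (x y : V.Var) : Mem V K :=
  if h : V.ty y = V.ty x then θ.set x (h ▸ θ y) else θ

end Mem

/-! ### Programs -/

/-- Functions, their locations, their local variables (`owner a = some f`; global variables
have owner `none`), formal parameters and return variables `ret_f`. -/
structure Decls (V : Vocab) where
  Fn : Type
  Loc : Type
  fnOf : Loc → Fn
  owner : V.Var → Option Fn
  arity : Fn → ℕ
  formal : (f : Fn) → Fin (arity f) → V.Var
  ret : Fn → V.Var

/-- The actions (other than branching conditions). `call (some x) f args` is `x := f(args)` and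
`call none f args` is `f(args)`. `ret f e` is the statement `ret e` in the function `f`. -/
inductive Action {V : Vocab} (D : Decls V)
  | assign (x : V.Var) (e : SymExpr V Empty 0 (V.ty x)) : Action D
  | call (dest : Option V.Var) (f : D.Fn)
      (args : (i : Fin (D.arity f)) → SymExpr V Empty 0 (V.ty (D.formal f i))) : Action D
  | ret (f : D.Fn) (e : SymExpr V Empty 0 (V.ty (D.ret f))) : Action D
  | skip : Action D

/-- The out-edges of a location: none, a single edge labelled by an action, or two edges
labelled by `γ` and `¬ γ`. -/
inductive OutEdges {V : Vocab} (D : Decls V)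
  | none : OutEdges D
  | single (a : Action D) (target : D.Loc) : OutEdges D
  | branch (γ : BoolExpr V Empty 0) (target target' : D.Loc) : OutEdges D

/-- `l'` is the target of one of the given out-edges. -/
def OutEdges.HasTarget {V : Vocab} {D : Decls V} (o : OutEdges D) (l' : D.Loc) : Prop :=
  match o with
  | .none => False
  | .single _ l => l' = l
  | .branch _ l₁ l₂ => l' = l₁ ∨ l' = l₂

structure Program (V : Vocab) extends Decls V where
  start : Fn
  entry : Fn → Loc
  exit : Fn → Loc
  out : Loc → OutEdges toDecls
  fnOf_entry : ∀ f, fnOf (entry f) = f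
  fnOf_exit : ∀ f, fnOf (exit f) = f
  entry_ne_exit : ∀ f, entry f ≠ exit f
  /-- Edges connect locations of the same function. -/
  fnOf_target : ∀ l l', (out l).HasTarget l' → fnOf l' = fnOf l
  no_edge_to_entry : ∀ l f, ¬ (out l).HasTarget (entry f)
  no_edge_from_exit : ∀ f, out (exit f) = .none
  formal_injective : ∀ f, Function.Injective (formal f)
  owner_formal : ∀ f i, owner (formal f i) = some f
  ret_injective : Function.Injective ret
  owner_ret : ∀ f, owner (ret f) = none
  ret_ok : ∀ l f e l', out l = .single (.ret f e) l' → f = fnOf l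
  call_ok : ∀ l dest f args l', out l = .single (.call dest f args) l' →
    f ≠ start ∧ (∀ g, l ≠ entry g) ∧ (∀ g, l' ≠ exit g) ∧ ∀ x ∈ dest, V.ty x = V.ty (ret f)

section States

variable {V : Vocab}

namespace Program

def IsEntry (P : Program V) (l : P.Loc) : Prop := ∃ f, l = P.entry f

def IsExit (P : Program V) (l : P.Loc) : Prop := ∃ f, l = P.exit f

/-- A location with a single out-edge, which is a `skip` back to it. -/
def IsError (P : Program V) (l : P.Loc) : Prop := P.out l = .single .skip l

/-- The locations at which an execution ends. -/
def IsFinal (P : Program V) (l : P.Loc) : Prop := l = P.exit P.start ∨ P.IsError l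

end Program

/-! ### Templates (as tuples), call stacks and program states -/

/-- An ordinary call stack record: the local variables of the caller, the return location, and
the variable (if any) which the returned value is assigned to. -/
structure CallRec (P : Program V) (K : Type) where
  σ : (a : V.Var) → Option (SymExpr V K 0 (V.ty a))
  retLoc : P.Loc
  dest : Option V.Var

/-- An entry `(θᵢ, φᵢ, Ξᵢ, lᵢ)` of a template; its only parameter is `() : Unit`.
All call stacks are written with the top record first. -/
structure TemplateExit (P : Program V) where
  θ : Mem V Unit
  φ : BoolExpr V Unit 0
  Ξ : List (CallRec P Unit)
  l : P.Loc

/-- The tuples `(l, n, {(θ₁, φ₁, Ξ₁, l₁), …, (θₙ, φₙ, Ξₙ, lₙ)})`. -/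
structure GenTemplate (P : Program V) where
  l : P.Loc
  n : ℕ
  exits : Fin n → TemplateExit P

/-- The tuples `(l, n, {(θ₁, φ₁, Ξ₁, l₁), …, (θₙ, φₙ, Ξₙ, lₙ)}, θ, l')`. -/
structure RecTemplate (P : Program V) extends GenTemplate P where
  θ : Mem V Unit
  l' : P.Loc

/-- Call stack records: ordinary ones, the special ones `(t, κ)`, and `(⊥, ⊥)`, which stands
for any record. -/
inductive StackRec (P : Program V) (K : Type)
  | call (r : CallRec P K) : StackRec P K
  | special (t : RecTemplate P) (κ : K) : StackRec P K
  | any : StackRec P K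

/-- Program states `(θ, φ, Ξ, l)`; the top of the call stack is the head of the list `Ξ`. -/
structure State (P : Program V) (K : Type) where
  θ : Mem V K
  φ : BoolExpr V K 0
  Ξ : List (StackRec P K)
  l : P.Loc

variable {P : Program V} {K K' : Type}

namespace CallRec

def rename (f : K → K') (r : CallRec P K) : CallRec P K' :=
  ⟨fun a => (r.σ a).map (·.rename f), r.retLoc, r.dest⟩

def value (ν : K → ℕ) (r : CallRec P K) : CallRec P Empty :=
  ⟨fun a => (r.σ a).map (·.value ν), r.retLoc, r.dest⟩

def comp (θ : Mem V K) (r : CallRec P K) : CallRec P K :=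
  ⟨fun a => (r.σ a).map (·.subst θ), r.retLoc, r.dest⟩

/-- The records are defined for the same variables, with equivalent values, and agree in the
other components. -/
def Equiv (r r' : CallRec P K) : Prop :=
  (∀ a, Option.Rel SymExpr.Equiv (r.σ a) (r'.σ a)) ∧ r.retLoc = r'.retLoc ∧ r.dest = r'.dest

end CallRec

namespace StackRec

def rename (f : K → K') : StackRec P K → StackRec P K'
  | call r => call (r.rename f)
  | special t κ => special t (f κ)
  | any => any

/-- A record `(t, κ)` becomes `ν(κ)` records `(⊥, ⊥)`. -/
def value (ν : K → ℕ) : StackRec P K → List (StackRec P Empty)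
  | call r => [call (r.value ν)]
  | special _ κ => List.replicate (ν κ) any
  | any => [any]

def comp (θ : Mem V K) : StackRec P K → StackRec P K
  | call r => call (r.comp θ)
  | special t κ => special t κ
  | any => any

def Equiv : StackRec P K → StackRec P K → Prop
  | any, _ => True
  | _, any => True
  | call r, call r' => r.Equiv r'
  | special t κ, special t' κ' => t = t' ∧ κ = κ'
  | _, _ => False

end StackRec

namespace State

def rename (f : K → K') (s : State P K) : State P K' :=
  ⟨s.θ.rename f, s.φ.rename f, s.Ξ.map (·.rename f), s.l⟩

/-- `s⟨ν⟩` -/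
def value (ν : K → ℕ) (s : State P K) : State P Empty :=
  ⟨s.θ.value ν, s.φ.value ν, s.Ξ.flatMap (·.value ν), s.l⟩

/-- The composition `s ∘ s'` (the records of `s'` lie above those of `s`). -/
def comp (s s' : State P K) : State P K :=
  ⟨s.θ.comp s'.θ, s.φ.and (s'.φ.subst s.θ), s'.Ξ.map (·.comp s.θ) ++ s.Ξ, s'.l⟩

/-- `s ≡ s'` -/
def Equiv (s s' : State P K) : Prop :=
  s.θ.Equiv s'.θ ∧ s.φ.Equiv s'.φ ∧ List.Forall₂ StackRec.Equiv s.Ξ s'.Ξ ∧ s.l = s'.l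

/-- Equivalence on global variables. -/
def GlobalEquiv (s s' : State P K) : Prop :=
  (∀ a, P.owner a = none → (s.θ a).Equiv (s'.θ a)) ∧ s.φ.Equiv s'.φ ∧
    List.Forall₂ StackRec.Equiv s.Ξ s'.Ξ ∧ s.l = s'.l

/-- The initial state. -/
def init (P : Program V) (K : Type) : State P K :=
  ⟨Mem.init V K, .tru, [], P.entry P.start⟩

end State

/-- The state `(θᵢ, φᵢ, Ξᵢ, lᵢ)`. -/
def GenTemplate.exitState (t : GenTemplate P) (i : Fin t.n) : State P Unit :=
  ⟨(t.exits i).θ, (t.exits i).φ, (t.exits i).Ξ.map .call, (t.exits i).l⟩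

/-- The state `(θᵢ, φᵢ, [(t, κ)] ∘ Ξᵢ, lᵢ)`. -/
def RecTemplate.exitState (t : RecTemplate P) (i : Fin t.n) : State P Unit :=
  ⟨(t.exits i).θ, (t.exits i).φ, (t.exits i).Ξ.map .call ++ [.special t ()], (t.exits i).l⟩

/-! ### Classic symbolic execution steps -/

open Classical in
/-- The local variables of the function `f` as stored in a call stack record. -/
noncomputable def Mem.locals (P : Program V) (θ : Mem V K) (f : P.Fn) :
    (a : V.Var) → Option (SymExpr V K 0 (V.ty a)) :=
  fun a => if P.owner a = some f then some (θ a) else none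

open Classical in
/-- The memory at the entry of the function `f` called with the given arguments: global variables
are kept, formal parameters get the arguments, other local variables are undefined. -/
noncomputable def Mem.enter (P : Program V) (θ : Mem V K) (f : P.Fn)
    (args : (i : Fin (P.arity f)) → SymExpr V Empty 0 (V.ty (P.formal f i))) : Mem V K :=
  fun a =>
    if P.owner a = none then θ a
    else if h : ∃ i, P.formal f i = a then h.choose_spec ▸ θ.exprIn (args h.choose)
    else .sym a

open Classical in
/-- The memory after the return from the function `f` to the record `r`: global variables are
kept, the local variables of the caller are restored, all others are undefined, and the returned
value is assigned to its destination. -/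
noncomputable def Mem.leave (P : Program V) (θ : Mem V K) (f : P.Fn) (r : CallRec P K) :
    Mem V K :=
  let θ' : Mem V K := fun a => if P.owner a = none then θ a else (r.σ a).getD (.sym a)
  match r.dest with
  | none => θ'
  | some x => θ'.copy x (P.ret f)

/-- `ClassicStep P s s'`: `s'` is one of the classic successors of `s` (satisfiability of its path
condition is not tested yet). -/
inductive ClassicStep (P : Program V) (s : State P K) : State P K → Prop
  | assign (x : V.Var) (e : SymExpr V Empty 0 (V.ty x)) (l' : P.Loc)
      (h : P.out s.l = .single (.assign x e) l') :
      ClassicStep P s ⟨s.θ.set x (s.θ.exprIn e), s.φ, s.Ξ, l'⟩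
  | skip (l' : P.Loc) (h : P.out s.l = .single .skip l') :
      ClassicStep P s ⟨s.θ, s.φ, s.Ξ, l'⟩
  | ret (f : P.Fn) (e : SymExpr V Empty 0 (V.ty (P.ret f))) (l' : P.Loc)
      (h : P.out s.l = .single (.ret f e) l') :
      ClassicStep P s ⟨s.θ.set (P.ret f) (s.θ.exprIn e), s.φ, s.Ξ, l'⟩
  | call (dest : Option V.Var) (f : P.Fn)
      (args : (i : Fin (P.arity f)) → SymExpr V Empty 0 (V.ty (P.formal f i))) (l' : P.Loc)
      (h : P.out s.l = .single (.call dest f args) l') :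
      ClassicStep P s ⟨s.θ.enter P f args, s.φ,
        .call ⟨s.θ.locals P (P.fnOf s.l), l', dest⟩ :: s.Ξ, P.entry f⟩
  | branchTrue (γ : BoolExpr V Empty 0) (l₁ l₂ : P.Loc) (h : P.out s.l = .branch γ l₁ l₂) :
      ClassicStep P s ⟨s.θ, s.φ.and (s.θ.boolIn γ), s.Ξ, l₁⟩
  | branchFalse (γ : BoolExpr V Empty 0) (l₁ l₂ : P.Loc) (h : P.out s.l = .branch γ l₁ l₂) :
      ClassicStep P s ⟨s.θ, s.φ.and (s.θ.boolIn γ.neg), s.Ξ, l₂⟩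
  | leave (f : P.Fn) (r : CallRec P K) (Ξ : List (StackRec P K)) (hl : s.l = P.exit f)
      (hΞ : s.Ξ = .call r :: Ξ) :
      ClassicStep P s ⟨s.θ.leave P f r, s.φ, Ξ, r.retLoc⟩

end States

/-! ### Symbolic execution trees -/

/-- A (possibly infinite) tree with vertices labelled in `S`, given by the label of the root and
the set of labels of the children of a vertex; the latter may depend on the label of the vertex
and on the labels of its proper ancestors (nearest first). -/
structure ExecTree (S : Type) where
  root : S
  children : S → List S → Set S

namespace ExecTree

variable {S : Type}

/-- Vertices are identified with the paths to them. -/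
inductive IsVertex (T : ExecTree S) : S → List S → Prop
  | root : IsVertex T T.root []
  | child {s s' : S} {anc : List S} (h : IsVertex T s anc) (h' : s' ∈ T.children s anc) :
      IsVertex T s' (s :: anc)

structure Vertex (T : ExecTree S) where
  s : S
  anc : List S
  isVertex : T.IsVertex s anc

variable {T : ExecTree S}

def Vertex.IsLeaf (u : T.Vertex) : Prop := T.children u.s u.anc = ∅

/-- `u ≤ v`: the vertex `u` lies on the path from the root to `v`. -/
instance : LE T.Vertex := ⟨fun u v => (u.s :: u.anc) <:+ (v.s :: v.anc)⟩

/-- `u < v`: `v` is a (not necessarily direct) successor of `u`. -/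
instance : LT T.Vertex := ⟨fun u v => u ≤ v ∧ u ≠ v⟩

end ExecTree

section Trees

variable {V : Vocab}

/-- The classic symbolic execution tree. -/
def classicTree (P : Program V) : ExecTree (State P Empty) where
  root := State.init P Empty
  children s _ := {s' | ¬ P.IsFinal s.l ∧ ClassicStep P s s' ∧ s'.φ.Sat}

variable {P : Program V}

/-- On the path from `u` to `w`, execution does not return from the function activation
in which `u` lies. -/
def Inside (u w : (classicTree P).Vertex) : Prop :=
  ∀ v : (classicTree P).Vertex, u ≤ v → v ≤ w → u.s.Ξ.length ≤ v.s.Ξ.length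

/-- The requirements common to both kinds of templates. -/
def GenTemplate.Basic (t : GenTemplate P) : Prop :=
  0 < t.n ∧ (∀ i, (t.exits i).φ.Sat) ∧
    (∀ i j, i ≠ j → ((t.exits i).φ.and (t.exits j).φ).Equiv (.neg .tru)) ∧
    ∀ i, ¬ P.IsEntry (t.exits i).l ∧ ¬ P.IsExit (t.exits i).l

/-- Templates with one parameter. -/
structure GenTemplate.IsTemplate (t : GenTemplate P) : Prop where
  basic : t.Basic
  l_not_entry : ¬ P.IsEntry t.l
  l_not_exit : ¬ P.IsExit t.l
  complete : ∀ u e : (classicTree P).Vertex, u.s.l = t.l → u ≤ e → e.IsLeaf →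
    ∃ w : (classicTree P).Vertex, u < w ∧ w ≤ e ∧ Inside u w ∧
      ∃ (i : Fin t.n) (ν : ℕ), w.s.Equiv (u.s.comp ((t.exitState i).value fun _ => ν))
  sound : ∀ (u : (classicTree P).Vertex) (i : Fin t.n) (ν : ℕ), u.s.l = t.l →
    (u.s.φ.and (((t.exits i).φ.value fun _ => ν).subst u.s.θ)).Sat →
    ∃ w : (classicTree P).Vertex, u < w ∧
      w.s.Equiv (u.s.comp ((t.exitState i).value fun _ => ν))

/-- The activation directly above the special record of a recursion template with exit
`x` is an activation of the function `f`: the bottom record of the call stack of `x` returns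
into `f`, or that stack is empty and the location of `x` lies in `f`. -/
def TemplateExit.LiesIn (x : TemplateExit P) (f : P.Fn) : Prop :=
  P.fnOf ((x.Ξ.getLast?.map CallRec.retLoc).getD x.l) = f

/-- `w'` is at the location `l'` and the call stack of `w` has there been reduced by its
topmost `m` records. -/
def ReturnsTo (w w' : (classicTree P).Vertex) (m : ℕ) (l' : P.Loc) : Prop :=
  w'.s.l = l' ∧ w'.s.Ξ = w.s.Ξ.drop m

/-- Recursion templates with one parameter. -/
structure RecTemplate.IsTemplate (t : RecTemplate P) : Prop where
  basic : t.Basic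
  function : ∃ f : P.Fn, t.l = P.entry f ∧ t.l' = P.exit f ∧ (∀ i, (t.exits i).LiesIn f) ∧
    ∃ l dest args target, P.out l = .single (.call dest f args) target
  complete : ∀ u e : (classicTree P).Vertex, u.s.l = t.l → u ≤ e → e.IsLeaf →
    ∃ w : (classicTree P).Vertex, u < w ∧ w ≤ e ∧ ¬ w.IsLeaf ∧ Inside u w ∧
      ∃ (i : Fin t.n) (ν : ℕ), w.s.Equiv (u.s.comp ((t.exitState i).value fun _ => ν)) ∧
        ∀ w' : (classicTree P).Vertex, w < w' → w' ≤ e →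
          ReturnsTo w w' (t.exits i).Ξ.length t.l' →
          (∀ v : (classicTree P).Vertex, w < v → v < w' →
            ¬ ReturnsTo w v (t.exits i).Ξ.length t.l') →
          ∃ u' : (classicTree P).Vertex, w' ≤ u' ∧ u' ≤ e ∧ ¬ u'.IsLeaf ∧ Inside u u' ∧
            u'.s.GlobalEquiv ⟨w'.s.θ.comp (t.θ.value fun _ => ν), w'.s.φ, u.s.Ξ, t.l'⟩
  sound : ∀ (u : (classicTree P).Vertex) (i : Fin t.n) (ν : ℕ), u.s.l = t.l →
    (u.s.φ.and (((t.exits i).φ.value fun _ => ν).subst u.s.θ)).Sat →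
    ∃ w : (classicTree P).Vertex, u < w ∧
      w.s.Equiv (u.s.comp ((t.exitState i).value fun _ => ν))

/-- Tuples of both kinds. -/
inductive Template (P : Program V)
  | general (t : GenTemplate P) : Template P
  | recursion (t : RecTemplate P) : Template P

namespace Template

/-- The entry location of a template. -/
def l : Template P → P.Loc
  | general t => t.l
  | recursion t => t.l

def IsTemplate : Template P → Prop
  | general t => t.IsTemplate
  | recursion t => t.IsTemplate

end Template

/-! ### Compact symbolic execution -/

/-- The compact execution is about to return from the recursion folded in the topmost record. -/
def Unwinds (s : State P ℕ) : Prop := ∃ t κ Ξ, s.Ξ = .special t κ :: Ξ ∧ s.l = t.l'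

/-- A template of the set `p` has to be instantiated at the state `s`. -/
def Instantiates (p : Set (Template P)) (s : State P ℕ) : Prop :=
  ¬ P.IsFinal s.l ∧ ¬ Unwinds s ∧ ∃ t ∈ p, t.l = s.l

/-- The successors of a non-final state `s` in the compact execution with the templates `p`, where
`c` is the template chosen at `s` and `κ` is the fresh parameter. -/
inductive CompactStep (p : Set (Template P)) (s : State P ℕ) (c : Template P) (κ : ℕ) :
    State P ℕ → Prop
  | unwind (t : RecTemplate P) (κ' : ℕ) (Ξ : List (StackRec P ℕ))
      (hΞ : s.Ξ = .special t κ' :: Ξ) (hl : s.l = t.l') :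
      CompactStep p s c κ ⟨s.θ.comp (t.θ.rename fun _ => κ'), s.φ, Ξ, t.l'⟩
  | recursion (h : Instantiates p s) (t : RecTemplate P) (hc : c = .recursion t) (i : Fin t.n) :
      CompactStep p s c κ (s.comp ((t.exitState i).rename fun _ => κ))
  | general (h : Instantiates p s) (t : GenTemplate P) (hc : c = .general t) (i : Fin t.n) :
      CompactStep p s c κ (s.comp ((t.exitState i).rename fun _ => κ))
  | classic (hu : ¬ Unwinds s) (hi : ¬ Instantiates p s) (s' : State P ℕ)
      (h : ClassicStep P s s') : CompactStep p s c κ s'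

/-- The compact symbolic execution tree built with the set `p` of templates. At the vertex with
label `s` and ancestors labelled by `anc`, the template `choose s anc` and the parameter
`fresh s anc` are used (if a template is instantiated there). -/
def compactTree (p : Set (Template P)) (choose : State P ℕ → List (State P ℕ) → Template P)
    (fresh : State P ℕ → List (State P ℕ) → ℕ) : ExecTree (State P ℕ) where
  root := State.init P ℕ
  children s anc :=
    {s' | ¬ P.IsFinal s.l ∧ CompactStep p s (choose s anc) (fresh s anc) s' ∧ s'.φ.Sat}

end Trees

end CSE

/-! The path of the classic tree from the root to the leaf `e` is followed in the compact tree. The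
invariant `Represents e u c ν` says that the vertex `u` of this path is the instance at `ν` of the
compact vertex `c`. Agreement is required semantically, for every valuation equal to `ν` on the
parameters introduced so far; hence a fresh parameter can receive its value later, without tracking
which parameters occur in which expression.

Each move leads strictly further down the path. A classic step is copied (`exists_classicStep`).
Where a template is instantiated, its completeness supplies a later vertex on the path, an exit and
an integer, which becomes the value of the fresh parameter (`exists_general`, `exists_recursion`). A
folded recursion is undone by `exists_unwind`.

The delicate point is the call stack. A record `(t, κ)` stands for `ν κ` actual records, and what
the completeness of `t` says about unwinding them concerns the future of the path. `StackSim`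
therefore stores it with the record as a promise `Pending`, valid until the stack drops below these
records. When the promise is redeemed, only the global variables agree; this is enough, because the
next step is a return, which restores the local variables from the record below (`Mem.Sim.leave`).
Two further invariants are needed: a special record reached by a return carries the exit of the
function being left, and an entry location other than that of the starting function has an ordinary
record on top, so that every special record lies directly on the record of a call.

Finally, a compact vertex representing `e` is a leaf (`Represents.isLeaf`): an unwinding or an
instantiation would yield a vertex of the path beyond `e`, and a classic step would need an edge or
a record that `e` does not have. -/

namespace CSE

/-! ### Semantics of the operations on expressions -/

section Semantics

variable {V : Vocab} {K K' : Type}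

/-- Assignments of values to the symbols. -/
abbrev Assignment (V : Vocab) : Type := (a : V.Var) → V.Val (V.ty a)

/-- The values of all variables in a symbolic memory. -/
def Mem.den (θ : Mem V K) (ρ : Assignment V) (κ : K → ℕ) : Assignment V :=
  fun a => (θ a).eval ρ κ Fin.elim0

namespace SymExpr

theorem eval_value {n : ℕ} (ν : K → ℕ) (ρ : Assignment V) (κ : Empty → ℕ) (b : Fin n → ℕ)
    {s : V.Srt} (e : SymExpr V K n s) : (e.value ν).eval ρ κ b = e.eval ρ ν b := by
  induction e with
  | op o args ih => simp only [value, eval, ih]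
  | _ => simp only [value, eval]

theorem eval_rename {n : ℕ} (f : K → K') (ρ : Assignment V) (κ : K' → ℕ) (b : Fin n → ℕ)
    {s : V.Srt} (e : SymExpr V K n s) :
    (e.rename f).eval ρ κ b = e.eval ρ (fun k => κ (f k)) b := by
  induction e with
  | op o args ih => simp only [rename, eval, ih]
  | _ => simp only [rename, eval]

theorem eval_lift {n : ℕ} (ρ : Assignment V) (κ : K → ℕ) (b : Fin n → ℕ)
    {s : V.Srt} (e : SymExpr V K 0 s) : (e.lift n).eval ρ κ b = e.eval ρ κ Fin.elim0 := by
  induction e with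
  | op o args ih => simp only [lift, eval, ih]
  | bound i => exact i.elim0
  | _ => simp only [lift, eval]

/-- The substitution lemma, to which the facts about composition reduce. The expressions in a memory
contain no bound parameters, so `lift` does not change their values under quantifiers. -/
theorem eval_subst {n : ℕ} (θ : Mem V K) (ρ : Assignment V) (κ : K → ℕ) (b : Fin n → ℕ)
    {s : V.Srt} (e : SymExpr V K n s) : (e.subst θ).eval ρ κ b = e.eval (θ.den ρ κ) κ b := by
  induction e with
  | op o args ih => simp only [subst, eval, ih]
  | sym a => simp only [subst, eval, eval_lift, Mem.den]
  | _ => simp only [subst, eval]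

end SymExpr

namespace BoolExpr

theorem holds_value {n : ℕ} (ν : K → ℕ) (ρ : Assignment V) (κ : Empty → ℕ) (b : Fin n → ℕ)
    (φ : BoolExpr V K n) : (φ.value ν).Holds ρ κ b ↔ φ.Holds ρ ν b := by
  induction φ with
  | tru => simp only [value, Holds]
  | eq e e' => simp only [value, Holds, SymExpr.eval_value]
  | rel r args => simp only [value, Holds, SymExpr.eval_value]
  | neg φ ih => simp only [value, Holds, ih]
  | and φ ψ ih ih' => simp only [value, Holds, ih, ih']
  | all φ ih => simp only [value, Holds, ih]

theorem holds_rename {n : ℕ} (f : K → K') (ρ : Assignment V) (κ : K' → ℕ) (b : Fin n → ℕ)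
    (φ : BoolExpr V K n) : (φ.rename f).Holds ρ κ b ↔ φ.Holds ρ (fun k => κ (f k)) b := by
  induction φ with
  | tru => simp only [rename, Holds]
  | eq e e' => simp only [rename, Holds, SymExpr.eval_rename]
  | rel r args => simp only [rename, Holds, SymExpr.eval_rename]
  | neg φ ih => simp only [rename, Holds, ih]
  | and φ ψ ih ih' => simp only [rename, Holds, ih, ih']
  | all φ ih => simp only [rename, Holds, ih]

theorem holds_subst {n : ℕ} (θ : Mem V K) (ρ : Assignment V) (κ : K → ℕ) (b : Fin n → ℕ)
    (φ : BoolExpr V K n) : (φ.subst θ).Holds ρ κ b ↔ φ.Holds (θ.den ρ κ) κ b := by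
  induction φ with
  | tru => simp only [subst, Holds]
  | eq e e' => simp only [subst, Holds, SymExpr.eval_subst]
  | rel r args => simp only [subst, Holds, SymExpr.eval_subst]
  | neg φ ih => simp only [subst, Holds, ih]
  | and φ ψ ih ih' => simp only [subst, Holds, ih, ih']
  | all φ ih => simp only [subst, Holds, ih]

end BoolExpr

theorem Mem.den_comp (θ θ' : Mem V K) (ρ : Assignment V) (κ : K → ℕ) :
    (θ.comp θ').den ρ κ = θ'.den (θ.den ρ κ) κ :=
  funext fun _ => SymExpr.eval_subst ..

theorem Mem.den_value (ν : K → ℕ) (θ : Mem V K) (ρ : Assignment V) (κ : Empty → ℕ) :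
    (θ.value ν).den ρ κ = θ.den ρ ν :=
  funext fun _ => SymExpr.eval_value ..

theorem Mem.den_rename (f : K → K') (θ : Mem V K) (ρ : Assignment V) (κ : K' → ℕ) :
    (θ.rename f).den ρ κ = θ.den ρ (fun k => κ (f k)) :=
  funext fun _ => SymExpr.eval_rename ..

theorem Mem.eval_exprIn (θ : Mem V K) {s : V.Srt} (e : SymExpr V Empty 0 s) (ρ : Assignment V)
    (κ : K → ℕ) :
    (θ.exprIn e).eval ρ κ Fin.elim0 = e.eval (θ.den ρ κ) Empty.elim Fin.elim0 := by
  rw [exprIn, SymExpr.eval_subst, SymExpr.eval_rename]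
  congr 1
  exact Subsingleton.elim _ _

theorem Mem.holds_boolIn (θ : Mem V K) (γ : BoolExpr V Empty 0) (ρ : Assignment V)
    (κ : K → ℕ) :
    (θ.boolIn γ).Holds ρ κ Fin.elim0 ↔ γ.Holds (θ.den ρ κ) Empty.elim Fin.elim0 := by
  rw [boolIn, BoolExpr.holds_subst, BoolExpr.holds_rename,
    Subsingleton.elim (fun k : Empty => κ k.elim) Empty.elim]

open Classical in
theorem Mem.den_set (θ : Mem V K) (x : V.Var) (e : SymExpr V K 0 (V.ty x)) (ρ : Assignment V)
    (κ : K → ℕ) :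
    (θ.set x e).den ρ κ = Function.update (θ.den ρ κ) x (e.eval ρ κ Fin.elim0) := by
  funext a
  by_cases h : a = x
  · subst h; simp [den, set]
  · simp [den, set, h]

theorem SymExpr.eval_cast {n : ℕ} {s s' : V.Srt} (h : s = s') (e : SymExpr V K n s)
    (ρ : Assignment V) (κ : K → ℕ) (b : Fin n → ℕ) :
    (h ▸ e : SymExpr V K n s').eval ρ κ b = (h ▸ e.eval ρ κ b : V.Val s') := by
  subst h; rfl

/-! ### Agreement of memories, path conditions and records under a valuation -/

/-- The memories have the same values when the parameters of the second are read in `ν`. -/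
def Mem.Sim (ν : ℕ → ℕ) (θ : Mem V Empty) (θ' : Mem V ℕ) : Prop :=
  ∀ ρ : Assignment V, θ.den ρ Empty.elim = θ'.den ρ ν

/-- The path conditions agree when the parameters of the second are read in `ν`. -/
def BoolExpr.Sim (ν : ℕ → ℕ) (φ : BoolExpr V Empty 0) (ψ : BoolExpr V ℕ 0) : Prop :=
  ∀ ρ : Assignment V, φ.Holds ρ Empty.elim Fin.elim0 ↔ ψ.Holds ρ ν Fin.elim0

/-- Ensures that compact candidates following the path are not dropped: a model of the classic
condition, with the parameters read in `ν`, is a model of the compact one. -/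
theorem BoolExpr.Sim.sat {ν : ℕ → ℕ} {φ : BoolExpr V Empty 0} {ψ : BoolExpr V ℕ 0}
    (h : φ.Sim ν ψ) (hφ : φ.Sat) : ψ.Sat := by
  obtain ⟨ρ, κ, hρ⟩ := hφ
  rw [Subsingleton.elim κ Empty.elim] at hρ
  exact ⟨ρ, ν, (h ρ).1 hρ⟩

theorem BoolExpr.Sim.and_boolIn {ν : ℕ → ℕ} {φ : BoolExpr V Empty 0} {ψ : BoolExpr V ℕ 0}
    {θ : Mem V Empty} {θ' : Mem V ℕ} (h : φ.Sim ν ψ) (hθ : θ.Sim ν θ') (γ : BoolExpr V Empty 0) :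
    (φ.and (θ.boolIn γ)).Sim ν (ψ.and (θ'.boolIn γ)) := by
  intro ρ
  simp only [Holds, Mem.holds_boolIn, h ρ, hθ ρ]

namespace Mem.Sim

variable {ν : ℕ → ℕ} {θ : Mem V Empty} {θ' : Mem V ℕ}

theorem set_exprIn (h : θ.Sim ν θ') (x : V.Var) (e : SymExpr V Empty 0 (V.ty x)) :
    (θ.set x (θ.exprIn e)).Sim ν (θ'.set x (θ'.exprIn e)) := by
  intro ρ
  simp only [den_set, eval_exprIn, h ρ]

theorem enter (h : θ.Sim ν θ') (P : Program V) (f : P.Fn)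
    (args : (i : Fin (P.arity f)) → SymExpr V Empty 0 (V.ty (P.formal f i))) :
    (θ.enter P f args).Sim ν (θ'.enter P f args) := by
  intro ρ
  funext a
  simp only [den, Mem.enter]
  split_ifs with h₁ h₂
  · exact congrFun (h ρ) a
  -- With the chosen index turned into a variable, the equation `P.formal f i = a` can be
  -- substituted and the transport disappears.
  · generalize_proofs pf
    generalize h₂.choose = i at pf
    subst pf
    simp only [eval_exprIn, h ρ]
  · rfl

theorem copy (h : θ.Sim ν θ') (x y : V.Var) : (θ.copy x y).Sim ν (θ'.copy x y) := by
  intro ρ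
  simp only [Mem.copy]
  split_ifs with h₁
  · simp only [den_set, SymExpr.eval_cast]
    rw [h ρ]
    congr 2
    exact congrFun (h ρ) y
  · exact h ρ

end Mem.Sim

variable {P : Program V}

/-- The records have the same values when the parameters of the second are read in `ν`. -/
def CallRec.Sim (ν : ℕ → ℕ) (r : CallRec P Empty) (r' : CallRec P ℕ) : Prop :=
  (∀ a, Option.Rel (fun e e' => ∀ ρ : Assignment V,
    e.eval ρ Empty.elim Fin.elim0 = e'.eval ρ ν Fin.elim0) (r.σ a) (r'.σ a)) ∧
  r.retLoc = r'.retLoc ∧ r.dest = r'.dest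

theorem CallRec.Sim.equiv_value {ν : ℕ → ℕ} {r : CallRec P Empty} {r' : CallRec P ℕ}
    (h : r.Sim ν r') : r.Equiv (r'.value ν) := by
  refine ⟨fun a => ?_, h.2.1, h.2.2⟩
  have := h.1 a
  revert this
  simp only [value]
  generalize r.σ a = x
  generalize r'.σ a = y
  rintro (h | _)
  · refine .some fun ρ κ => ?_
    rw [SymExpr.eval_value, Subsingleton.elim κ Empty.elim, h ρ]
  · exact .none

/-- A record equivalent to an instance of a template record, composed with a memory. -/
theorem CallRec.Sim.of_equiv_comp {ν : ℕ → ℕ} {θ : Mem V Empty} {θ' : Mem V ℕ}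
    (hθ : θ.Sim ν θ') {r : CallRec P Empty} {x : CallRec P Unit} {κ : ℕ}
    (h : r.Equiv ((x.value fun _ => ν κ).comp θ)) :
    r.Sim ν ((x.rename fun _ => κ).comp θ') := by
  refine ⟨fun a => ?_, h.2.1, h.2.2⟩
  have := h.1 a
  revert this
  simp only [value, comp, rename]
  generalize r.σ a = y
  generalize x.σ a = z
  intro h
  cases z with
  | none => cases h; exact .none
  | some z =>
    cases h with
    | some h =>
      refine .some fun ρ => ?_
      rw [h ρ, SymExpr.eval_subst, SymExpr.eval_subst, SymExpr.eval_value, SymExpr.eval_rename,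
        hθ ρ]

theorem Mem.Sim.locals {ν : ℕ → ℕ} {θ : Mem V Empty} {θ' : Mem V ℕ} (h : θ.Sim ν θ') (f : P.Fn)
    (l : P.Loc) (dest : Option V.Var) :
    CallRec.Sim ν (P := P) ⟨θ.locals P f, l, dest⟩ ⟨θ'.locals P f, l, dest⟩ := by
  refine ⟨fun a => ?_, rfl, rfl⟩
  simp only [Mem.locals]
  split_ifs
  · exact .some fun ρ => congrFun (h ρ) a
  · exact .none

/-- Only the global variables matter for a return. -/
theorem Mem.Sim.leave {ν : ℕ → ℕ} {θ : Mem V Empty} {θ' : Mem V ℕ}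
    (h : ∀ a, P.owner a = none → ∀ ρ : Assignment V, θ.den ρ Empty.elim a = θ'.den ρ ν a)
    (f : P.Fn) {r : CallRec P Empty} {r' : CallRec P ℕ} (hr : r.Sim ν r') :
    (θ.leave P f r).Sim ν (θ'.leave P f r') := by
  classical
  have key : Mem.Sim (V := V) ν
      (fun a => if P.owner a = none then θ a else (r.σ a).getD (.sym a))
      (fun a => if P.owner a = none then θ' a else (r'.σ a).getD (.sym a)) := by
    intro ρ
    funext a
    simp only [den]
    split_ifs with h₁
    · exact h a h₁ ρ
    · have := hr.1 a
      revert this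
      generalize r.σ a = x
      generalize r'.σ a = y
      rintro (h | _)
      · exact h ρ
      · rfl
  simp only [Mem.leave, hr.2.2]
  cases r'.dest with
  | none => exact key
  | some x => exact key.copy x (P.ret f)

end Semantics

/-! ### The order of the vertices of a tree -/

namespace ExecTree

variable {S : Type} {T : ExecTree S}

namespace Vertex

theorem le_def {u v : T.Vertex} : u ≤ v ↔ (u.s :: u.anc) <:+ (v.s :: v.anc) := Iff.rfl

theorem ext_path {u v : T.Vertex} (h : u.s :: u.anc = v.s :: v.anc) : u = v := by
  cases u; cases v; cases h; rfl

theorem le_refl (u : T.Vertex) : u ≤ u := List.suffix_refl _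

theorem le_trans {u v w : T.Vertex} (h : u ≤ v) (h' : v ≤ w) : u ≤ w := List.IsSuffix.trans h h'

theorem le_antisymm {u v : T.Vertex} (h : u ≤ v) (h' : v ≤ u) : u = v :=
  ext_path (List.IsSuffix.eq_of_length h (Nat.le_antisymm h.length_le h'.length_le))

theorem le_total_of_le {u v w : T.Vertex} (h : u ≤ w) (h' : v ≤ w) : u ≤ v ∨ v ≤ u :=
  List.suffix_or_suffix_of_suffix h h'

theorem length_lt_of_lt {u v : T.Vertex} (h : u < v) : u.anc.length < v.anc.length := by
  have h₁ : (u.s :: u.anc).length ≤ (v.s :: v.anc).length := List.IsSuffix.length_le h.1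
  have h₂ : (u.s :: u.anc).length ≠ (v.s :: v.anc).length := fun hl =>
    h.2 (ext_path (List.IsSuffix.eq_of_length h.1 hl))
  simp only [List.length_cons] at h₁ h₂
  omega

theorem length_le_of_le {u v : T.Vertex} (h : u ≤ v) : u.anc.length ≤ v.anc.length := by
  simpa using List.IsSuffix.length_le h

theorem lt_of_lt_of_le {u v w : T.Vertex} (h : u < v) (h' : v ≤ w) : u < w :=
  ⟨le_trans h.1 h', fun hu => h.2 (le_antisymm h.1 (hu ▸ h'))⟩

/-- `v` is a child of `u`. -/
def IsChild (u v : T.Vertex) : Prop := v.anc = u.s :: u.anc ∧ v.s ∈ T.children u.s u.anc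

/-- The child of `u` with a given label. -/
def child (u : T.Vertex) (s : S) (h : s ∈ T.children u.s u.anc) : T.Vertex :=
  ⟨s, u.s :: u.anc, u.isVertex.child h⟩

theorem isChild_child (u : T.Vertex) (s : S) (h : s ∈ T.children u.s u.anc) :
    u.IsChild (u.child s h) := ⟨rfl, h⟩

theorem IsChild.lt {u v : T.Vertex} (h : u.IsChild v) : u < v := by
  refine ⟨?_, ?_⟩
  · rw [le_def, h.1]; exact List.suffix_cons _ _
  · rintro rfl
    have := congrArg List.length h.1
    simp at this

theorem IsChild.le {u v : T.Vertex} (h : u.IsChild v) : u ≤ v := h.lt.1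

theorem IsChild.eq_or_eq {u v x : T.Vertex} (h : u.IsChild v) (hu : u ≤ x) (hv : x ≤ v) :
    x = u ∨ x = v := by
  rw [le_def, List.suffix_cons_iff, h.1] at hv
  rcases hv with hv | hv
  · exact .inr (ext_path (by rw [hv, h.1]))
  · exact .inl (le_antisymm hv hu)

theorem exists_child {u w : T.Vertex} (h : u < w) : ∃ v : T.Vertex, u.IsChild v ∧ v ≤ w := by
  obtain ⟨s, anc, hw⟩ := w
  induction hw with
  | root =>
    obtain ⟨h, hne⟩ := h
    rw [le_def, List.suffix_cons_iff] at h
    rcases h with h | h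
    · exact absurd (ext_path h) hne
    · simp at h
  | @child s s' anc hs hs' ih =>
    obtain ⟨h, hne⟩ := h
    rw [le_def, List.suffix_cons_iff] at h
    rcases h with h | h
    · exact absurd (ext_path h) hne
    · by_cases hu : u = ⟨s, anc, hs⟩
      · subst hu
        exact ⟨⟨s', s :: anc, hs.child hs'⟩, ⟨rfl, hs'⟩, le_refl _⟩
      · obtain ⟨v, hv, hvs⟩ := ih ⟨h, hu⟩
        exact ⟨v, hv, List.IsSuffix.trans hvs (List.suffix_cons _ _)⟩

theorem not_lt_of_isLeaf {u v : T.Vertex} (h : u.IsLeaf) : ¬ u < v := by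
  intro huv
  obtain ⟨x, hx, -⟩ := exists_child huv
  have := hx.2
  rw [h] at this
  exact this

theorem lt_of_not_isLeaf {u e : T.Vertex} (h : u ≤ e) (hu : ¬ u.IsLeaf) (he : e.IsLeaf) : u < e :=
  ⟨h, fun hue => hu (hue ▸ he)⟩

/-- Induction along the path from `u` to one of its successors. -/
theorem le_induction {u : T.Vertex} {C : T.Vertex → Prop} (base : C u)
    (step : ∀ v w : T.Vertex, u ≤ v → v.IsChild w → C v → C w) :
    ∀ w : T.Vertex, u ≤ w → C w := by
  rintro ⟨s, anc, hw⟩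
  induction hw with
  | root =>
    intro h
    rw [le_def, List.suffix_cons_iff] at h
    rcases h with h | h
    · rw [← ext_path h]; exact base
    · simp at h
  | @child s s' anc hs hs' ih =>
    intro h
    rw [le_def, List.suffix_cons_iff] at h
    rcases h with h | h
    · rw [← ext_path h]; exact base
    · exact step ⟨s, anc, hs⟩ _ h ⟨rfl, hs'⟩ (ih h)

/-- The root of a tree. -/
def root (T : ExecTree S) : T.Vertex := ⟨T.root, [], .root⟩

theorem root_le (v : T.Vertex) : root T ≤ v := by
  obtain ⟨s, anc, h⟩ := v
  induction h with
  | root => exact le_refl _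
  | child _ _ ih => exact List.IsSuffix.trans ih (List.suffix_cons _ _)

end Vertex

end ExecTree

open ExecTree

section ClassicTree

variable {V : Vocab} {P : Program V}

/-! ### The classic tree -/

namespace Program

theorem exit_injective (P : Program V) : Function.Injective P.exit := fun f g h => by
  rw [← P.fnOf_exit f, h, P.fnOf_exit]

theorem not_isEntry_of_hasTarget {l l' : P.Loc} (h : (P.out l).HasTarget l') : ¬ P.IsEntry l' := by
  rintro ⟨f, rfl⟩
  exact P.no_edge_to_entry _ _ h

theorem not_isEntry_exit (P : Program V) (f : P.Fn) : ¬ P.IsEntry (P.exit f) := by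
  rintro ⟨g, hg⟩
  have := congrArg P.fnOf hg
  rw [P.fnOf_entry, P.fnOf_exit] at this
  subst this
  exact P.entry_ne_exit _ hg.symm

end Program

/-- At an exit location the only step is a return. -/
theorem ClassicStep.at_exit {K : Type} {s s' : State P K} (h : ClassicStep P s s') {f : P.Fn}
    (hf : s.l = P.exit f) :
    ∃ r Ξ, s.Ξ = .call r :: Ξ ∧ s' = ⟨s.θ.leave P f r, s.φ, Ξ, r.retLoc⟩ := by
  have hout := P.no_edge_from_exit f
  cases h with
  | leave g r Ξ hl hΞ =>
    obtain rfl := P.exit_injective (hl.symm.trans hf)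
    exact ⟨r, Ξ, hΞ, rfl⟩
  | _ => simp_all

namespace classicTree

theorem sat (u : (classicTree P).Vertex) : u.s.φ.Sat := by
  obtain ⟨s, anc, h⟩ := u
  cases h with
  | root => exact ⟨fun a => (V.val_nonempty _).some, Empty.elim, trivial⟩
  | child _ h => exact h.2.2

theorem step {u v : (classicTree P).Vertex} (h : u.IsChild v) : ClassicStep P u.s v.s := h.2.2.1

/-- The stack of a vertex consists of ordinary records with non-entry return locations. -/
theorem stack_ordinary (u : (classicTree P).Vertex) :
    ∀ x ∈ u.s.Ξ, ∃ r, x = .call r ∧ ¬ P.IsEntry r.retLoc := by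
  obtain ⟨s, anc, h⟩ := u
  induction h with
  | root => intro x hx; cases hx
  | @child s s' anc hs hs' ih =>
    simp only at ih ⊢
    cases hs'.2.1 with
    -- Only a call adds a record, and its return location is the target of an edge.
    | call dest f args l' h =>
      intro x hx
      rcases List.mem_cons.1 hx with rfl | hx
      · exact ⟨_, rfl, Program.not_isEntry_of_hasTarget (l := s.l) (by rw [h]; rfl)⟩
      · exact ih x hx
    | leave f r Ξ hl hΞ =>
      intro x hx
      exact ih x (by rw [hΞ]; exact List.mem_cons_of_mem _ hx)
    | _ => exact ih

end classicTree

/-- The location, in the activation at the bottom of the records `B`, at which the execution is or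
will be when the control returns to this activation. -/
def baseLoc {K : Type} (B : List (CallRec P K)) (l : P.Loc) : P.Loc :=
  (B.getLast?.map CallRec.retLoc).getD l

theorem baseLoc_cons {K : Type} (r : CallRec P K) (B : List (CallRec P K)) (l : P.Loc) :
    baseLoc (r :: B) l = baseLoc B r.retLoc := by
  cases B with
  | nil => rfl
  | cons r' B => simp [baseLoc, List.getLast?_cons]

/-- Serves to transfer `LiesIn` from the records of a template exit to the actual records on the
path. -/
theorem baseLoc_congr {K K' : Type} {B : List (CallRec P K)} {B' : List (CallRec P K')}
    (h : List.Forall₂ (fun r r' => r.retLoc = r'.retLoc) B B') (l : P.Loc) :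
    baseLoc B l = baseLoc B' l := by
  induction h generalizing l with
  | nil => rfl
  | cons h _ ih => rw [baseLoc_cons, baseLoc_cons, h, ih]

/-- As long as the activation of `u` is not left, the stack of `u` stays at the bottom of the
stack, and the activation above it is one of the same function. -/
theorem Inside.exists_stack {u w : (classicTree P).Vertex} (huw : u ≤ w) (h : Inside u w) :
    ∃ B : List (CallRec P Empty), w.s.Ξ = B.map .call ++ u.s.Ξ ∧
      P.fnOf (baseLoc B w.s.l) = P.fnOf u.s.l := by
  revert h
  refine Vertex.le_induction (u := u) (C := fun w => Inside u w →
    ∃ B : List (CallRec P Empty), w.s.Ξ = B.map .call ++ u.s.Ξ ∧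
      P.fnOf (baseLoc B w.s.l) = P.fnOf u.s.l) ?_ ?_ w huw
  · exact fun _ => ⟨[], rfl, rfl⟩
  · intro v w huv hvw ih h
    obtain ⟨B, hB, hfn⟩ := ih fun x hx hxv => h x hx (Vertex.le_trans hxv hvw.le)
    have hlen := h w (Vertex.le_trans huv hvw.le) (Vertex.le_refl w)
    have hstep := classicTree.step hvw
    -- An edge stays in its function; and if `B` is non-empty, the base location is a return
    -- location, which the edge does not affect.
    have same : ∀ l', (P.out v.s.l).HasTarget l' →
        P.fnOf (baseLoc B l') = P.fnOf u.s.l := by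
      intro l' hl'
      rw [← hfn]
      cases B with
      | nil => exact P.fnOf_target _ _ hl'
      | cons r B => rw [baseLoc_cons, baseLoc_cons]
    generalize w.s = s at hstep hlen ⊢
    cases hstep with
    | assign x e l' h => exact ⟨B, hB, same _ (by rw [h]; rfl)⟩
    | skip l' h => exact ⟨B, hB, same _ (by rw [h]; rfl)⟩
    | ret f e l' h => exact ⟨B, hB, same _ (by rw [h]; rfl)⟩
    | branchTrue γ l₁ l₂ h => exact ⟨B, hB, same _ (by rw [h]; exact .inl rfl)⟩
    | branchFalse γ l₁ l₂ h => exact ⟨B, hB, same _ (by rw [h]; exact .inr rfl)⟩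
    | call dest f args l' h =>
      refine ⟨_ :: B, by rw [hB]; rfl, ?_⟩
      rw [baseLoc_cons]
      exact same _ (by rw [h]; rfl)
    | leave f r Ξ hl hΞ =>
      cases B with
      -- A return with no record above the stack of `u` would leave the activation of `u`.
      | nil =>
        rw [List.map_nil, List.nil_append] at hB
        rw [← hB, hΞ] at hlen
        simp at hlen
      | cons b B =>
        rw [hΞ] at hB
        simp only [List.map_cons, List.cons_append, List.cons.injEq, StackRec.call.injEq] at hB
        obtain ⟨rfl, rfl⟩ := hB
        exact ⟨B, rfl, by rw [← hfn, baseLoc_cons]⟩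

/-- A leaf at a non-final location has no classic successors, and it is not at an exit location
with a non-empty stack. -/
theorem classicTree.out_of_isLeaf {e : (classicTree P).Vertex} (he : e.IsLeaf)
    (hf : ¬ P.IsFinal e.s.l) : P.out e.s.l = .none ∧ (P.IsExit e.s.l → e.s.Ξ = []) := by
  have no : ∀ s', ClassicStep P e.s s' → ¬ s'.φ.Sat := fun s' h h' =>
    Set.eq_empty_iff_forall_notMem.1 he s' ⟨hf, h, h'⟩
  have hsat := classicTree.sat e
  constructor
  · cases hout : P.out e.s.l with
    | none => rfl
    | single a l' =>
      exfalso
      cases a with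
      | assign x t => exact no _ (.assign x t l' hout) hsat
      | call dest f args => exact no _ (.call dest f args l' hout) hsat
      | ret f t => exact no _ (.ret f t l' hout) hsat
      | skip => exact no _ (.skip l' hout) hsat
    | branch γ l₁ l₂ =>
      exfalso
      -- A model of the path condition satisfies `γ` or its negation, so one of the two successors
      -- is satisfiable.
      obtain ⟨ρ, κ, h⟩ := hsat
      by_cases hγ : (e.s.θ.boolIn γ).Holds ρ κ Fin.elim0
      · exact no _ (.branchTrue γ l₁ l₂ hout) ⟨ρ, κ, h, hγ⟩
      · exact no _ (.branchFalse γ l₁ l₂ hout) ⟨ρ, κ, h, hγ⟩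
  · rintro ⟨f, hl⟩
    rcases hΞ : e.s.Ξ with - | ⟨x, Ξ⟩
    · rfl
    · obtain ⟨r, rfl, -⟩ := classicTree.stack_ordinary e x (by rw [hΞ]; exact List.mem_cons_self)
      exact (no _ (.leave f r Ξ hl hΞ) hsat).elim

end ClassicTree

section Simulation

variable {V : Vocab} {P : Program V}

/-! ### Simulation of call stacks -/

/-- The call stacks agree when the parameters of the second are read in any `ν ∈ N`. Here `g` is the
function of the current activation, and each special record represents records `A` lying above the
record of the call at which its template was instantiated; it satisfies `Q`. -/
inductive StackSim
    (Q : RecTemplate P → ℕ → List (StackRec P Empty) → List (StackRec P Empty) → Prop)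
    (N : Set (ℕ → ℕ)) : P.Fn → List (StackRec P Empty) → List (StackRec P ℕ) → Prop
  | nil (g : P.Fn) : StackSim Q N g [] []
  | call (g : P.Fn) {r : CallRec P Empty} {r' : CallRec P ℕ} {R : List (StackRec P Empty)}
      {R' : List (StackRec P ℕ)}
      (hr : ∀ ν ∈ N, r.Sim ν r') (h : StackSim Q N (P.fnOf r.retLoc) R R') :
      StackSim Q N g (.call r :: R) (.call r' :: R')
  | special {g : P.Fn} {t : RecTemplate P} {κ : ℕ} {A : List (StackRec P Empty)}
      {r : CallRec P Empty} {r' : CallRec P ℕ} {R : List (StackRec P Empty)}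
      {R' : List (StackRec P ℕ)} (ht : t.l' = P.exit g) (hA : ∀ ν ∈ N, A.length = ν κ)
      (hr : ∀ ν ∈ N, r.Sim ν r')
      (h : StackSim Q N (P.fnOf r.retLoc) R R')
      (hQ : Q t A.length (A ++ .call r :: R) (.call r :: R)) :
      StackSim Q N g (A ++ .call r :: R) (.special t κ :: .call r' :: R')

namespace StackSim

variable {Q Q' : RecTemplate P → ℕ → List (StackRec P Empty) → List (StackRec P Empty) → Prop}
  {N : Set (ℕ → ℕ)} {g : P.Fn} {L : List (StackRec P Empty)} {L' : List (StackRec P ℕ)}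

/-- Each promise concerns a suffix of `L`. The resulting bound on `A` lets a single lower bound on
the stack height preserve all promises at once in `advance`. -/
theorem mono (h : StackSim Q N g L L')
    (hQ : ∀ t n A R, A.length ≤ L.length → Q t n A R → Q' t n A R) : StackSim Q' N g L L' := by
  induction h with
  | nil g => exact .nil g
  | call g hr _ ih =>
    exact .call g hr (ih fun t n A R hA => hQ t n A R (Nat.le_succ_of_le hA))
  | special ht hA hr _ hq ih =>
    refine .special ht hA hr (ih fun t n A R hA => hQ t n A R ?_) (hQ _ _ _ _ le_rfl hq)
    simp only [List.length_append, List.length_cons]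
    omega

theorem equiv_value (h : StackSim Q N g L L') {ν : ℕ → ℕ} (hν : ν ∈ N) :
    List.Forall₂ StackRec.Equiv L (L'.flatMap (·.value ν)) := by
  induction h with
  | nil g => exact .nil
  | call g hr _ ih => exact .cons (hr ν hν).equiv_value ih
  | @special g t κ A r r' R R' ht hA hr _ hq ih =>
    rw [List.flatMap_cons]
    refine List.rel_append ?_ (.cons (hr ν hν).equiv_value ih)
    -- The contents of `A` are irrelevant: only its length has to match the number of records `(⊥,
    -- ⊥)`.
    rw [StackRec.value, ← hA ν hν, List.forall₂_iff_get]
    refine ⟨by simp, fun i h₁ h₂ => ?_⟩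
    simp only [List.get_eq_getElem, List.getElem_replicate]
    cases A[i] <;> trivial

theorem eq_call (h : StackSim Q N g L L') {r' : CallRec P ℕ} {R' : List (StackRec P ℕ)}
    (hL : L' = .call r' :: R') :
    ∃ r R, L = .call r :: R ∧ (∀ ν ∈ N, r.Sim ν r') ∧ StackSim Q N (P.fnOf r.retLoc) R R' := by
  cases h with
  | nil => cases hL
  | call _ hr h => cases hL; exact ⟨_, _, rfl, hr, h⟩
  | special => cases hL

theorem eq_special (h : StackSim Q N g L L') {t : RecTemplate P} {κ : ℕ}
    {R' : List (StackRec P ℕ)} (hL : L' = .special t κ :: R') :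
    t.l' = P.exit g ∧ ∃ r r' R T, R' = .call r' :: T ∧ (∀ ν ∈ N, r.Sim ν r') ∧
      StackSim Q N (P.fnOf r.retLoc) R T ∧
      ∃ n, (∀ ν ∈ N, n = ν κ) ∧ Q t n L (.call r :: R) := by
  cases h with
  | nil => cases hL
  | call => cases hL
  | special ht hA hr h hQ => cases hL; exact ⟨ht, _, _, _, _, rfl, hr, h, _, hA, hQ⟩

theorem eq_nil_iff (h : StackSim Q N g L L') : L = [] ↔ L' = [] := by
  cases h <;> simp

theorem ne_any (h : StackSim Q N g L L') (R' : List (StackRec P ℕ)) : L' ≠ .any :: R' := by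
  cases h <;> simp

theorem antitone (h : StackSim Q N g L L') {N' : Set (ℕ → ℕ)} (hN : N' ⊆ N) :
    StackSim Q N' g L L' := by
  induction h with
  | nil g => exact .nil g
  | call g hr _ ih => exact .call g (fun ν hν => hr ν (hN hν)) ih
  | special ht hA hr _ hq ih =>
    exact .special ht (fun ν hν => hA ν (hN hν)) (fun ν hν => hr ν (hN hν)) ih hq

/-- Ordinary records put on top of the stacks. -/
theorem push {B : List (CallRec P Empty)} {B' : List (CallRec P ℕ)}
    (hB : List.Forall₂ (fun r r' => ∀ ν ∈ N, r.Sim ν r') B B') {l : P.Loc}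
    (h : StackSim Q N (P.fnOf (baseLoc B l)) L L') :
    StackSim Q N (P.fnOf l) (B.map .call ++ L) (B'.map .call ++ L') := by
  induction hB generalizing l with
  | nil => exact h
  | cons hr _ ih =>
    rw [baseLoc_cons] at h
    exact .call _ hr (ih h)

end StackSim

/-- What the completeness of the recursion template `t` provides for a special record, at the
vertex `u` of the path to the leaf `e`: if the execution reaches the exit `t.l'` with the call stack
`A` without having had a smaller stack before, then it reaches `t.l'` again with the call
stack `R`, the global variables being changed by `t.θ`. -/
def Pending (e u : (classicTree P).Vertex) (t : RecTemplate P) (n : ℕ)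
    (A R : List (StackRec P Empty)) : Prop :=
  ∀ w : (classicTree P).Vertex, u ≤ w → w ≤ e → w.s.l = t.l' → w.s.Ξ = A →
    (∀ v : (classicTree P).Vertex, u ≤ v → v ≤ w → A.length ≤ v.s.Ξ.length) →
    ∃ u' : (classicTree P).Vertex, w ≤ u' ∧ u' ≤ e ∧ ¬ u'.IsLeaf ∧ u'.s.l = t.l' ∧ u'.s.Ξ = R ∧
      (∀ v : (classicTree P).Vertex, w ≤ v → v ≤ u' → R.length ≤ v.s.Ξ.length) ∧
      (∀ a, P.owner a = none → ∀ ρ : Assignment V,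
        u'.s.θ.den ρ Empty.elim a = t.θ.den (w.s.θ.den ρ Empty.elim) (fun _ => n) a) ∧
      u'.s.φ.Equiv w.s.φ

/-- The condition on the stack heights from `u` to `w` splits at `v`: the first part is `hlen`, the
second is what the new promise assumes. -/
theorem Pending.mono {e u v : (classicTree P).Vertex} {t : RecTemplate P} {n : ℕ}
    {A R : List (StackRec P Empty)} (h : Pending e u t n A R) (huv : u ≤ v)
    (hlen : ∀ x : (classicTree P).Vertex, u ≤ x → x ≤ v → A.length ≤ x.s.Ξ.length) :
    Pending e v t n A R := by
  intro w hvw hwe hl hΞ hw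
  refine h w (Vertex.le_trans huv hvw) hwe hl hΞ fun x hux hxw => ?_
  rcases Vertex.le_total_of_le hxw hvw with hx | hx
  · exact hlen x hux hx
  · exact hw x hx hxw

theorem StackSim.advance {e u v : (classicTree P).Vertex} {N : Set (ℕ → ℕ)} {g : P.Fn}
    {L : List (StackRec P Empty)} {L' : List (StackRec P ℕ)} (h : StackSim (Pending e u) N g L L')
    (huv : u ≤ v)
    (hlen : ∀ x : (classicTree P).Vertex, u ≤ x → x ≤ v → L.length ≤ x.s.Ξ.length) :
    StackSim (Pending e v) N g L L' :=
  h.mono fun _ _ _ _ hA hp => hp.mono huv fun x hu hv => hA.trans (hlen x hu hv)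

theorem StackSim.advance_child {e u v : (classicTree P).Vertex} {N : Set (ℕ → ℕ)} {g : P.Fn}
    {L : List (StackRec P Empty)} {L' : List (StackRec P ℕ)} (h : StackSim (Pending e u) N g L L')
    (huv : u.IsChild v) (hu : L.length ≤ u.s.Ξ.length) (hv : L.length ≤ v.s.Ξ.length) :
    StackSim (Pending e v) N g L L' := by
  refine h.advance huv.le fun x hux hxv => ?_
  rcases huv.eq_or_eq hux hxv with rfl | rfl
  exacts [hu, hv]

/-! ### Simulation of states -/

/-- The vertex `u` on the path to the leaf `e` of the classic tree is represented by the state `c`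
of the compact tree, for all values `ν ∈ N` of the parameters. -/
structure Simulates (e u : (classicTree P).Vertex) (c : State P ℕ) (N : Set (ℕ → ℕ)) : Prop where
  nonempty : N.Nonempty
  mem : ∀ ν ∈ N, u.s.θ.Sim ν c.θ
  cond : ∀ ν ∈ N, u.s.φ.Sim ν c.φ
  stack : StackSim (Pending e u) N (P.fnOf u.s.l) u.s.Ξ c.Ξ
  loc : u.s.l = c.l
  entry : P.IsEntry c.l → c.l = P.entry P.start ∨ ∃ r Ξ, c.Ξ = .call r :: Ξ

namespace Simulates

variable {e u : (classicTree P).Vertex} {c : State P ℕ} {N : Set (ℕ → ℕ)}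

theorem equiv_value (h : Simulates e u c N) {ν : ℕ → ℕ} (hν : ν ∈ N) : u.s.Equiv (c.value ν) := by
  refine ⟨fun a ρ κ => ?_, fun ρ κ => ?_, h.stack.equiv_value hν, h.loc⟩
  · rw [Subsingleton.elim κ Empty.elim]
    exact (congrFun (h.mem ν hν ρ) a).trans (SymExpr.eval_value ..).symm
  · rw [Subsingleton.elim κ Empty.elim]
    exact (h.cond ν hν ρ).trans (BoolExpr.holds_value ..).symm

theorem init (e : (classicTree P).Vertex) {N : Set (ℕ → ℕ)} (hN : N.Nonempty) :
    Simulates e (Vertex.root _) (State.init P ℕ) N :=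
  ⟨hN, fun _ _ _ => rfl, fun _ _ _ => Iff.rfl, .nil _, rfl, fun _ => .inl rfl⟩

/-! ### Classic steps and the return from a folded recursion -/

/-- A classic step other than a return from a special record is simulated by a classic step. -/
theorem exists_classicStep (h : Simulates e u c N) {v : (classicTree P).Vertex}
    (huv : u.IsChild v) (hc : ¬ Unwinds c) :
    ∃ c', ClassicStep P c c' ∧ Simulates e v c' N := by
  have hstep := classicTree.step huv
  have same : ∀ (l' : P.Loc), (P.out u.s.l).HasTarget l' → v.s.Ξ = u.s.Ξ →
      StackSim (Pending e v) N (P.fnOf l') u.s.Ξ c.Ξ := by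
    intro l' hl' hΞ
    rw [P.fnOf_target _ _ hl']
    exact h.stack.advance_child huv le_rfl (by rw [hΞ])
  generalize hs : v.s = s at hstep
  cases hstep with
  | assign x t l' ho =>
    have ht : (P.out u.s.l).HasTarget l' := by rw [ho]; rfl
    refine ⟨_, .assign x t l' (h.loc ▸ ho),
      ⟨h.nonempty, fun ν hν => ?_, fun ν hν => ?_, ?_, ?_, fun he => ?_⟩⟩
    · rw [hs]; exact (h.mem ν hν).set_exprIn x t
    · rw [hs]; exact h.cond ν hν
    · have := same l' ht (by rw [hs])
      rw [hs]; exact this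
    · rw [hs]
    · exact absurd he (Program.not_isEntry_of_hasTarget ht)
  | skip l' ho =>
    have ht : (P.out u.s.l).HasTarget l' := by rw [ho]; rfl
    refine ⟨_, .skip l' (h.loc ▸ ho),
      ⟨h.nonempty, fun ν hν => ?_, fun ν hν => ?_, ?_, ?_, fun he => ?_⟩⟩
    · rw [hs]; exact h.mem ν hν
    · rw [hs]; exact h.cond ν hν
    · have := same l' ht (by rw [hs])
      rw [hs]; exact this
    · rw [hs]
    · exact absurd he (Program.not_isEntry_of_hasTarget ht)
  | ret f t l' ho =>
    have ht : (P.out u.s.l).HasTarget l' := by rw [ho]; rfl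
    refine ⟨_, .ret f t l' (h.loc ▸ ho),
      ⟨h.nonempty, fun ν hν => ?_, fun ν hν => ?_, ?_, ?_, fun he => ?_⟩⟩
    · rw [hs]; exact (h.mem ν hν).set_exprIn (P.ret f) t
    · rw [hs]; exact h.cond ν hν
    · have := same l' ht (by rw [hs])
      rw [hs]; exact this
    · rw [hs]
    · exact absurd he (Program.not_isEntry_of_hasTarget ht)
  | branchTrue γ l₁ l₂ ho =>
    have ht : (P.out u.s.l).HasTarget l₁ := by rw [ho]; exact .inl rfl
    refine ⟨_, .branchTrue γ l₁ l₂ (h.loc ▸ ho),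
      ⟨h.nonempty, fun ν hν => ?_, fun ν hν => ?_, ?_, ?_, fun he => ?_⟩⟩
    · rw [hs]; exact h.mem ν hν
    · rw [hs]; exact (h.cond ν hν).and_boolIn (h.mem ν hν) γ
    · have := same l₁ ht (by rw [hs])
      rw [hs]; exact this
    · rw [hs]
    · exact absurd he (Program.not_isEntry_of_hasTarget ht)
  | branchFalse γ l₁ l₂ ho =>
    have ht : (P.out u.s.l).HasTarget l₂ := by rw [ho]; exact .inr rfl
    refine ⟨_, .branchFalse γ l₁ l₂ (h.loc ▸ ho),
      ⟨h.nonempty, fun ν hν => ?_, fun ν hν => ?_, ?_, ?_, fun he => ?_⟩⟩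
    · rw [hs]; exact h.mem ν hν
    · rw [hs]; exact (h.cond ν hν).and_boolIn (h.mem ν hν) γ.neg
    · have := same l₂ ht (by rw [hs])
      rw [hs]; exact this
    · rw [hs]
    · exact absurd he (Program.not_isEntry_of_hasTarget ht)
  | call dest f args l' ho =>
    have ht : (P.out u.s.l).HasTarget l' := by rw [ho]; rfl
    refine ⟨_, .call dest f args l' (h.loc ▸ ho),
      ⟨h.nonempty, fun ν hν => ?_, fun ν hν => ?_, ?_, ?_, fun _ => ?_⟩⟩
    · rw [hs]; exact (h.mem ν hν).enter P f args
    · rw [hs]; exact h.cond ν hν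
    · have hst : StackSim (Pending e v) N (P.fnOf l') u.s.Ξ c.Ξ := by
        rw [P.fnOf_target _ _ ht]
        exact h.stack.advance_child huv le_rfl (by rw [hs]; exact Nat.le_succ _)
      rw [hs, ← h.loc]
      exact .call _ (fun ν hν => (h.mem ν hν).locals _ l' dest) hst
    · rw [hs]
    · exact .inr ⟨_, _, rfl⟩
  | leave f r Ξ hl hΞ =>
    rcases hcΞ : c.Ξ with - | ⟨x, Ξ'⟩
    · rw [h.stack.eq_nil_iff.2 hcΞ] at hΞ
      cases hΞ
    cases x with
    | any => exact absurd hcΞ (h.stack.ne_any Ξ')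
    | special t κ =>
      -- The exit stored with the special record is that of the current function, so the compact
      -- execution would have to unwind here, contrary to `hc`.
      obtain ⟨ht, -⟩ := h.stack.eq_special hcΞ
      rw [hl, P.fnOf_exit] at ht
      exact absurd ⟨t, κ, Ξ', hcΞ, by rw [← h.loc, hl, ht]⟩ hc
    | call r' =>
      refine ⟨_, .leave f r' Ξ' (h.loc ▸ hl) hcΞ, ?_⟩
      obtain ⟨r₀, R, hR, hr, hst⟩ := h.stack.eq_call hcΞ
      rw [hΞ] at hR
      simp only [List.cons.injEq, StackRec.call.injEq] at hR
      obtain ⟨rfl, rfl⟩ := hR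
      obtain ⟨ν₀, hν₀⟩ := h.nonempty
      refine ⟨⟨ν₀, hν₀⟩, fun ν hν => ?_, fun ν hν => ?_, ?_, ?_, fun he => ?_⟩
      · rw [hs]; exact Mem.Sim.leave (fun a _ ρ => congrFun (h.mem ν hν ρ) a) f (hr ν hν)
      · rw [hs]; exact h.cond ν hν
      · have := hst.advance_child huv (by rw [hΞ]; exact Nat.le_succ _) (by rw [hs])
        rw [hs]; exact this
      · rw [hs]; exact (hr ν₀ hν₀).2.1
      · obtain ⟨r₁, hr₁, hne⟩ := classicTree.stack_ordinary u (.call r) (by rw [hΞ]; simp)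
        cases hr₁
        exact absurd he (by rw [← (hr ν₀ hν₀).2.1]; exact hne)

/-- The return from the recursion folded in a special record, followed by the return from the
function of its template. -/
theorem exists_unwind (h : Simulates e u c N) (he : e.IsLeaf) (hue : u ≤ e) {t : RecTemplate P}
    {κ : ℕ} {Ξ : List (StackRec P ℕ)} (hΞ : c.Ξ = .special t κ :: Ξ) (hl : c.l = t.l') :
    ∃ f, t.l' = P.exit f ∧ ∃ r Ξ', Ξ = .call r :: Ξ' ∧ ∃ v, u < v ∧ v ≤ e ∧
      ∃ c', ClassicStep P ⟨c.θ.comp (t.θ.rename fun _ => κ), c.φ, Ξ, t.l'⟩ c' ∧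
        Simulates e v c' N := by
  obtain ⟨ν₀, hν₀⟩ := h.nonempty
  obtain ⟨ht, r, r', R, T, rfl, hr, hst, n, hn, hp⟩ := h.stack.eq_special hΞ
  -- The promise is redeemed at `u` itself, where the condition on stack heights concerns `u` alone.
  obtain ⟨u', huu', hu'e, hleaf, hl', hΞ', hlen, hglob, hφ⟩ :=
    hp u (Vertex.le_refl u) hue (h.loc.trans hl) rfl fun v hv hv' => by
      rw [Vertex.le_antisymm hv hv']
  -- Since `u'` is not a leaf, the path continues, and from an exit location it can only return to
  -- `r`.
  obtain ⟨v, huv, hve⟩ := Vertex.exists_child (Vertex.lt_of_not_isLeaf hu'e hleaf he)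
  obtain ⟨r₀, R₀, hΞ₀, hs⟩ := (classicTree.step huv).at_exit (hl'.trans ht)
  rw [hΞ'] at hΞ₀
  simp only [List.cons.injEq, StackRec.call.injEq] at hΞ₀
  obtain ⟨rfl, rfl⟩ := hΞ₀
  refine ⟨_, ht, r', T, rfl, v, ⟨Vertex.le_trans huu' huv.le, ?_⟩, hve, _,
    .leave _ r' T ht rfl, h.nonempty, fun ν hν => ?_, fun ν hν => ?_, ?_, ?_, fun hent => ?_⟩
  · rintro rfl
    exact huv.lt.2 (Vertex.le_antisymm huv.le huu')
  · rw [hs]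
    -- The promise describes `t.θ` only on global variables; the return overwrites the rest.
    refine Mem.Sim.leave (fun a ha ρ => ?_) _ (hr ν hν)
    rw [hglob a ha ρ, Mem.den_comp, Mem.den_rename, h.mem ν hν ρ, hn ν hν]
  · rw [hs]
    exact fun ρ => (hφ ρ _).trans (h.cond ν hν ρ)
  · have key : StackSim (Pending e v) N (P.fnOf r.retLoc) R T := by
      refine StackSim.advance_child (hst.advance huu' fun x hux hxu => ?_) huv ?_ ?_
      · exact (Nat.le_succ _).trans (hlen x hux hxu)
      · rw [hΞ']; exact Nat.le_succ _
      · rw [hs]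
    rw [hs]; exact key
  · rw [hs]; exact (hr ν₀ hν₀).2.1
  · obtain ⟨r₁, hr₁, hne⟩ := classicTree.stack_ordinary u' (.call r) (by rw [hΞ']; simp)
    cases hr₁
    exact absurd hent (by rw [← (hr ν₀ hν₀).2.1]; exact hne)

/-! ### Instantiation of templates -/

/-- The memory after the instantiation of a template. -/
theorem mem_comp (h : Simulates e u c N) {w : State P Empty} {x : State P Unit} {n κ : ℕ}
    (hw : w.Equiv (u.s.comp (x.value fun _ => n))) {ν : ℕ → ℕ} (hν : ν ∈ N) (hκ : ν κ = n) :
    w.θ.Sim ν (c.comp (x.rename fun _ => κ)).θ := by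
  intro ρ
  have : w.θ.den ρ Empty.elim = (u.s.θ.comp (x.θ.value fun _ => n)).den ρ Empty.elim :=
    funext fun a => hw.1 a ρ _
  rw [this, Mem.den_comp, Mem.den_value, State.comp, State.rename, Mem.den_comp, Mem.den_rename,
    h.mem ν hν ρ, hκ]

/-- The path condition after the instantiation of a template. -/
theorem cond_comp (h : Simulates e u c N) {w : State P Empty} {x : State P Unit} {n κ : ℕ}
    (hw : w.Equiv (u.s.comp (x.value fun _ => n))) {ν : ℕ → ℕ} (hν : ν ∈ N) (hκ : ν κ = n) :
    w.φ.Sim ν (c.comp (x.rename fun _ => κ)).φ := by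
  intro ρ
  rw [hw.2.1 ρ]
  simp only [State.comp, State.rename, State.value, BoolExpr.Holds, BoolExpr.holds_subst,
    BoolExpr.holds_value, BoolExpr.holds_rename, h.mem ν hν ρ, hκ, h.cond ν hν ρ]

/-- The ordinary records pushed by the instantiation of a template. -/
theorem records_comp (h : Simulates e u c N) {B : List (CallRec P Empty)}
    {X : List (CallRec P Unit)} {Y Z : List (StackRec P Empty)} {n κ : ℕ}
    (hB : List.Forall₂ StackRec.Equiv (B.map .call ++ Y)
      (X.map (fun x => .call ((x.value fun _ => n).comp u.s.θ)) ++ Z))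
    (hlen : B.length = X.length) (hκ : ∀ ν ∈ N, ν κ = n) :
    List.Forall₂ (fun r r' => ∀ ν ∈ N, r.Sim ν r') B
      (X.map fun x => (x.rename fun _ => κ).comp c.θ) := by
  -- Both stacks have equally many records on top, so they can be cut at the same place, whatever
  -- lies below.
  have := List.forall₂_take B.length hB
  rw [List.take_left' (by simp), List.take_left' (by simp [hlen]), List.forall₂_map_left_iff,
    List.forall₂_map_right_iff] at this
  rw [List.forall₂_map_right_iff]
  refine this.imp fun r x hrx ν hν => ?_
  obtain rfl := hκ ν hν
  exact CallRec.Sim.of_equiv_comp (h.mem ν hν) hrx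

/-- Used to narrow the valuations to those giving a fresh parameter its value. -/
theorem antitone (h : Simulates e u c N) {N' : Set (ℕ → ℕ)} (hN : N' ⊆ N) (hne : N'.Nonempty) :
    Simulates e u c N' :=
  ⟨hne, fun ν hν => h.mem ν (hN hν), fun ν hν => h.cond ν (hN hν), h.stack.antitone hN, h.loc,
    h.entry⟩

/-- The instantiation of a template. -/
theorem exists_general (h : Simulates e u c N) (he : e.IsLeaf) (hue : u ≤ e) {t : GenTemplate P}
    (ht : t.IsTemplate) (hl : t.l = c.l) :
    ∃ v, u < v ∧ v ≤ e ∧ ∃ (i : Fin t.n) (n : ℕ), ∀ (κ : ℕ) (N' : Set (ℕ → ℕ)), N' ⊆ N →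
      N'.Nonempty → (∀ ν ∈ N', ν κ = n) →
      Simulates e v (c.comp ((t.exitState i).rename fun _ => κ)) N' := by
  obtain ⟨w, huw, hwe, hin, i, n, hw⟩ := ht.complete u e (h.loc.trans hl.symm) hue he
  refine ⟨w, huw, hwe, i, n, fun κ N' hN hne hκ => ?_⟩
  replace h := h.antitone hN hne
  have hwl : w.s.l = (t.exits i).l := hw.2.2.2
  refine ⟨hne, fun ν hν => h.mem_comp hw hν (hκ ν hν), fun ν hν => h.cond_comp hw hν (hκ ν hν),
    ?_, hwl, fun hent => absurd hent (ht.basic.2.2.2 i).1⟩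
  obtain ⟨B, hB, hfn⟩ := hin.exists_stack huw.1
  have hΞ := hw.2.2.1
  simp only [State.comp, State.value, GenTemplate.exitState, List.flatMap_map, StackRec.value,
    List.map_map, Function.comp_def, StackRec.comp, ← List.map_eq_flatMap] at hΞ
  rw [hB] at hΞ
  have hlen := hΞ.length_eq
  simp only [List.length_append, List.length_map, Nat.add_right_cancel_iff] at hlen
  -- The activation of `u` is not left before `w`, so the promises in its stack survive and the
  -- activation above that stack is still one of the same function.
  have key : StackSim (Pending e w) N' (P.fnOf (baseLoc B w.s.l)) u.s.Ξ c.Ξ := by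
    rw [hfn]; exact h.stack.advance huw.1 hin
  have := StackSim.push (h.records_comp hΞ hlen hκ) key
  rw [hB]
  simpa [State.comp, State.rename, GenTemplate.exitState, Function.comp_def, StackRec.rename,
    StackRec.comp] using this

/-- The instantiation of a recursion template. -/
theorem exists_recursion (h : Simulates e u c N) (he : e.IsLeaf) (hue : u ≤ e)
    {t : RecTemplate P} (ht : t.IsTemplate) (hl : t.l = c.l) :
    ∃ v, u < v ∧ v ≤ e ∧ ∃ (i : Fin t.n) (n : ℕ), ∀ (κ : ℕ) (N' : Set (ℕ → ℕ)), N' ⊆ N →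
      N'.Nonempty → (∀ ν ∈ N', ν κ = n) →
      Simulates e v (c.comp ((t.exitState i).rename fun _ => κ)) N' := by
  obtain ⟨w, huw, hwe, -, hin, i, n, hw, hret⟩ := ht.complete u e (h.loc.trans hl.symm) hue he
  refine ⟨w, huw, hwe, i, n, fun κ N' hN hne hκ => ?_⟩
  replace h := h.antitone hN hne
  have hwl : w.s.l = (t.exits i).l := hw.2.2.2
  refine ⟨hne, fun ν hν => h.mem_comp hw hν (hκ ν hν), fun ν hν => h.cond_comp hw hν (hκ ν hν),
    ?_, hwl, fun hent => absurd hent (ht.basic.2.2.2 i).1⟩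
  obtain ⟨f, hlf, hlf', hlies, l₀, dest, args, target, hcall⟩ := ht.function
  -- The function of a recursion template is called somewhere, hence is not the starting one; so the
  -- entry invariant provides an ordinary top record.
  obtain ⟨r', T, hcΞ⟩ : ∃ r Ξ, c.Ξ = .call r :: Ξ := by
    refine (h.entry ⟨f, hl.symm.trans hlf⟩).resolve_left fun hstart => ?_
    have := congrArg P.fnOf (hstart.symm.trans (hl.symm.trans hlf))
    rw [P.fnOf_entry, P.fnOf_entry] at this
    exact (P.call_ok _ _ _ _ _ hcall).1 this.symm
  obtain ⟨r, R, huΞ, hr, hst⟩ := h.stack.eq_call hcΞ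
  obtain ⟨B₀, hB₀, -⟩ := hin.exists_stack huw.1
  have hΞ := hw.2.2.1
  simp only [State.comp, State.value, RecTemplate.exitState, List.flatMap_append, List.flatMap_map,
    StackRec.value, List.map_append, List.map_map, Function.comp_def, StackRec.comp,
    ← List.map_eq_flatMap, List.flatMap_cons, List.flatMap_nil, List.append_nil,
    List.map_replicate, List.append_assoc] at hΞ
  have hlen := hΞ.length_eq
  rw [hB₀] at hlen
  simp only [List.length_append, List.length_map, List.length_replicate] at hlen
  -- Of the records above the stack of `u`, the upper ones realise those of the template exit, and
  -- the `n` lower ones are folded into the special record.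
  obtain ⟨B, A, rfl, hBlen, hAlen⟩ : ∃ B A, B₀ = B ++ A ∧ B.length = (t.exits i).Ξ.length ∧
      A.length = n :=
    ⟨B₀.take (t.exits i).Ξ.length, B₀.drop (t.exits i).Ξ.length,
      (List.take_append_drop _ _).symm, by rw [List.length_take]; omega,
      by rw [List.length_drop]; omega⟩
  rw [List.map_append, List.append_assoc] at hB₀
  rw [hB₀] at hΞ
  have hrec := h.records_comp hΞ hBlen hκ
  have hdrop : w.s.Ξ.drop (t.exits i).Ξ.length = A.map .call ++ u.s.Ξ := by
    rw [hB₀, List.drop_left' (by simpa using hBlen)]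
  have hpend : Pending e w t n (A.map .call ++ u.s.Ξ) u.s.Ξ := by
    intro w' hww' hw'e hl' hΞ' hmin
    -- A template exit is never at an exit location, whereas `w'` is.
    have hne : w ≠ w' := by
      rintro rfl
      exact (ht.basic.2.2.2 i).2 ⟨f, by rw [← hwl, hl', hlf']⟩
    obtain ⟨u', hw'u', hu'e, hleaf, hin', hglob, hφ, hst', hl''⟩ :=
      hret w' ⟨hww', hne⟩ hw'e ⟨hl', hΞ'.trans hdrop.symm⟩ fun v hwv hvw' hv => by
        -- `w'` is the first such vertex: the step after an earlier one would be a return and would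
        -- push the stack below the bound `hmin`.
        obtain ⟨y, hvy, hyw⟩ := Vertex.exists_child hvw'
        obtain ⟨r₀, R₀, hR₀, hs⟩ := (classicTree.step hvy).at_exit (hv.1.trans hlf')
        have h₁ := hmin y (Vertex.le_trans hwv.1 hvy.le) hyw
        rw [← hdrop, ← hv.2, hR₀, hs] at h₁
        exact absurd h₁ (by simp)
    -- Equality of stacks, not just equivalence, is needed: being inside `u`, the vertex `u'` keeps
    -- the stack of `u` at the bottom, and the lengths leave no room for more.
    obtain ⟨D, hD, -⟩ := hin'.exists_stack
      (Vertex.le_trans huw.1 (Vertex.le_trans hww' hw'u'))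
    have hD0 : D = [] := by
      have h₁ := hst'.length_eq
      rw [hD] at h₁
      simp only [List.length_append, List.length_map] at h₁
      exact List.eq_nil_of_length_eq_zero (by omega)
    subst hD0
    refine ⟨u', hw'u', hu'e, hleaf, hl'', hD, fun v hv hv' =>
      hin' v (Vertex.le_trans huw.1 (Vertex.le_trans hww' hv)) hv', fun a ha ρ => ?_, hφ⟩
    have h₁ := hglob a ha ρ Empty.elim
    have h₂ := congrFun (Mem.den_comp w'.s.θ (t.θ.value fun _ => n) ρ Empty.elim) a
    rw [Mem.den_value] at h₂
    exact h₁.trans h₂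
  -- By `LiesIn`, the activation directly above the folded records is one of `f`, so the special
  -- record will be met at the exit of `f`.
  have hbase : P.fnOf (baseLoc B w.s.l) = f := by
    rw [← hlies i, hwl, baseLoc_congr (B' := (t.exits i).Ξ)]
    · rfl
    · rw [List.forall₂_map_right_iff] at hrec
      exact hrec.imp fun _ _ h' => (h' _ hne.some_mem).2.1
  have hst₁ : StackSim (Pending e w) N' (P.fnOf r.retLoc) R T :=
    hst.advance huw.1 fun x hx hx' => by
      refine le_trans ?_ (hin x hx hx')
      rw [huΞ]; exact Nat.le_succ _
  have key : StackSim (Pending e w) N' (P.fnOf (baseLoc B w.s.l)) (A.map .call ++ u.s.Ξ)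
      (.special t κ :: c.Ξ) := by
    rw [hbase, huΞ, hcΞ]
    rw [huΞ] at hpend
    refine .special hlf' (fun ν hν => ?_) hr hst₁ ?_
    · rw [List.length_map, hAlen, hκ ν hν]
    · rwa [List.length_map, hAlen]
  have := StackSim.push hrec key
  rw [hB₀]
  simpa [State.comp, State.rename, RecTemplate.exitState, Function.comp_def, StackRec.rename,
    StackRec.comp] using this

end Simulates

end Simulation

section Compact

variable {V : Vocab} {P : Program V} {p : Set (Template P)}
  {choose : State P ℕ → List (State P ℕ) → Template P}
  {fresh : State P ℕ → List (State P ℕ) → ℕ}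

/-! ### Soundness of compact symbolic execution -/

/-- The parameters introduced by the template instantiations above a vertex. -/
def usedParams (c : (compactTree p choose fresh).Vertex) : Set ℕ :=
  {k | ∃ a : (compactTree p choose fresh).Vertex, a < c ∧ Instantiates p a.s ∧ fresh a.s a.anc = k}

theorem usedParams_mono {c c' : (compactTree p choose fresh).Vertex} (h : c ≤ c') :
    usedParams c ⊆ usedParams c' := by
  rintro k ⟨a, ha, hi, rfl⟩
  exact ⟨a, Vertex.lt_of_lt_of_le ha h, hi, rfl⟩

/-- The vertex `u` on the path to `e` is represented by the vertex `c` of the compact tree, if the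
parameters used so far have the values `ν`. -/
def Represents (e u : (classicTree P).Vertex) (c : (compactTree p choose fresh).Vertex)
    (ν : ℕ → ℕ) : Prop :=
  Simulates e u c.s {ν' | Set.EqOn ν' ν (usedParams c)}

/-- More used parameters mean fewer admissible valuations, and `ν` always remains among them. -/
theorem Represents.of_le {e u : (classicTree P).Vertex}
    {c c' : (compactTree p choose fresh).Vertex} {ν : ℕ → ℕ} (hc : c ≤ c')
    (h : Simulates e u c'.s {ν' | Set.EqOn ν' ν (usedParams c)}) : Represents e u c' ν :=
  h.antitone (fun _ hν => Set.EqOn.mono (usedParams_mono hc) hν) ⟨ν, fun _ _ => rfl⟩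

theorem Simulates.sat {e u : (classicTree P).Vertex} {c : State P ℕ} {N : Set (ℕ → ℕ)}
    (h : Simulates e u c N) : c.φ.Sat := by
  obtain ⟨ν, hν⟩ := h.nonempty
  exact (h.cond ν hν).sat (classicTree.sat u)

theorem classicTree.not_isFinal_of_lt {u v : (classicTree P).Vertex} (h : u < v) :
    ¬ P.IsFinal u.s.l := by
  obtain ⟨x, hx, -⟩ := Vertex.exists_child h
  exact hx.2.1

/-- No template can be instantiated at an exit location. -/
theorem not_instantiates_exit (hp : ∀ t ∈ p, t.IsTemplate) {s : State P ℕ} {f : P.Fn}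
    (hs : s.l = P.exit f) : ¬ Instantiates p s := by
  rintro ⟨-, -, t, ht, hl⟩
  have := hp t ht
  cases t with
  | general t => exact this.l_not_exit ⟨f, hl.trans hs⟩
  | recursion t =>
    obtain ⟨g, hg, -⟩ := this.function
    exact P.not_isEntry_exit f ⟨g, hs.symm.trans (hl.symm.trans hg)⟩

/-- The instantiation of a template of either kind. -/
theorem Simulates.exists_instance {e u : (classicTree P).Vertex} {c : State P ℕ}
    {N : Set (ℕ → ℕ)} (h : Simulates e u c N) (he : e.IsLeaf) (hue : u ≤ e) {t : Template P}
    (ht : t.IsTemplate) (hl : t.l = c.l) (hi : Instantiates p c) (κ : ℕ) :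
    ∃ v, u < v ∧ v ≤ e ∧ ∃ (c' : State P ℕ) (n : ℕ), CompactStep p c t κ c' ∧
      ∀ N' : Set (ℕ → ℕ), N' ⊆ N → N'.Nonempty → (∀ ν ∈ N', ν κ = n) → Simulates e v c' N' := by
  cases t with
  | general t =>
    obtain ⟨v, huv, hve, i, n, H⟩ := h.exists_general he hue ht hl
    exact ⟨v, huv, hve, _, n, .general hi t rfl i, H κ⟩
  | recursion t =>
    obtain ⟨v, huv, hve, i, n, H⟩ := h.exists_recursion he hue ht hl
    exact ⟨v, huv, hve, _, n, .recursion hi t rfl i, H κ⟩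

/-- A vertex of the compact tree which represents a leaf is a leaf. -/
theorem Represents.isLeaf (hp : ∀ t ∈ p, t.IsTemplate) {e : (classicTree P).Vertex}
    (he : e.IsLeaf) {c : (compactTree p choose fresh).Vertex} {ν : ℕ → ℕ}
    (h : Represents e e c ν) : c.IsLeaf := by
  refine Set.eq_empty_iff_forall_notMem.2 ?_
  rintro s' ⟨hfin, hstep, -⟩
  have hu : ¬ Unwinds c.s := by
    rintro ⟨t, κ, Ξ, hΞ, hl⟩
    obtain ⟨-, -, -, -, -, v, hv, -⟩ := h.exists_unwind he (Vertex.le_refl e) hΞ hl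
    exact Vertex.not_lt_of_isLeaf he hv
  have hi : ¬ Instantiates p c.s := by
    intro hi
    obtain ⟨t, ht, hl⟩ := hi.2.2
    -- The parameter `0` is arbitrary; only the later vertex on the path matters.
    obtain ⟨v, hv, -⟩ := h.exists_instance he (Vertex.le_refl e) (hp t ht) hl hi 0
    exact Vertex.not_lt_of_isLeaf he hv
  -- What remains is a classic step, but there is no out-edge, and at an exit location the stack is
  -- empty.
  obtain ⟨hout, hex⟩ := classicTree.out_of_isLeaf he (by rw [h.loc]; exact hfin)
  rw [h.loc] at hout
  have hcl : ClassicStep P c.s s' := by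
    cases hstep with
    | unwind t κ Ξ hΞ hl => exact absurd ⟨t, κ, Ξ, hΞ, hl⟩ hu
    | recursion h' => exact absurd h' hi
    | general h' => exact absurd h' hi
    | classic _ _ _ h' => exact h'
  cases hcl with
  | leave f r Ξ hl hΞ =>
    rw [h.stack.eq_nil_iff.1 (hex ⟨f, h.loc.trans hl⟩)] at hΞ
    cases hΞ
  | _ => simp_all

/-- The compact tree follows the path to a leaf of the classic tree. -/
theorem Represents.exists_step (hp : ∀ t ∈ p, t.IsTemplate)
    (hchoose : ∀ s anc, (∃ t ∈ p, t.l = s.l) → choose s anc ∈ p ∧ (choose s anc).l = s.l)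
    (hfresh : ∀ u v : (compactTree p choose fresh).Vertex, u < v →
      Instantiates p u.s → Instantiates p v.s → fresh u.s u.anc ≠ fresh v.s v.anc)
    {e u : (classicTree P).Vertex} (he : e.IsLeaf) (hue : u < e)
    {c : (compactTree p choose fresh).Vertex} {ν : ℕ → ℕ} (h : Represents e u c ν) :
    ∃ (v : (classicTree P).Vertex) (c' : (compactTree p choose fresh).Vertex) (ν' : ℕ → ℕ),
      u < v ∧ v ≤ e ∧ Represents e v c' ν' := by
  have hfin : ¬ P.IsFinal c.s.l := h.loc ▸ classicTree.not_isFinal_of_lt hue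
  by_cases hu : Unwinds c.s
  · obtain ⟨t, κ, Ξ, hΞ, hl⟩ := hu
    obtain ⟨f, hf, r, Ξ', rfl, v, huv, hve, s₂, hs₂, hsim⟩ := h.exists_unwind he hue.1 hΞ hl
    -- Unwinding and the return after it form one move: at `c₁` only global variables are known to
    -- agree, so `c₁` need not represent any vertex of the path.
    let c₁ := c.child ⟨c.s.θ.comp (t.θ.rename fun _ => κ), c.s.φ, .call r :: Ξ', t.l'⟩
      ⟨hfin, .unwind t κ _ hΞ hl, h.sat⟩
    have hu₁ : ¬ Unwinds c₁.s := by
      rintro ⟨t', κ', Ξ'', h', -⟩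
      cases h'
    let c₂ := c₁.child s₂ ⟨by rw [hl] at hfin; exact hfin,
      .classic hu₁ (not_instantiates_exit hp hf) s₂ hs₂, hsim.sat⟩
    have hle : c ≤ c₂ := Vertex.le_trans (Vertex.isChild_child c _ _).le
      (Vertex.isChild_child c₁ _ _).le
    exact ⟨v, c₂, ν, huv, hve, .of_le hle hsim⟩
  by_cases hi : Instantiates p c.s
  · obtain ⟨hmem, hl⟩ := hchoose c.s c.anc hi.2.2
    set κ := fresh c.s c.anc with hκ
    obtain ⟨v, huv, hve, s', n, hstep, H⟩ :=
      h.exists_instance he hue.1 (hp _ hmem) hl hi κ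
    have hκc : κ ∉ usedParams c := by
      rintro ⟨a, ha, hia, hak⟩
      exact hfresh a c ha hia hi hak
    -- Since `κ` is new, giving it the value `n` does not disturb the parameters used at `c`, and
    -- the agreement established there still applies.
    have hsub : ∀ c' : (compactTree p choose fresh).Vertex, c ≤ c' →
        {ν' | Set.EqOn ν' (Function.update ν κ n) (usedParams c')} ⊆
        {ν' | Set.EqOn ν' ν (usedParams c)} := fun c' hc ν' hν' k hk => by
      rw [hν' (usedParams_mono hc hk), Function.update_of_ne]
      rintro rfl
      exact hκc hk
    -- One valuation suffices here; satisfiability must be known before the child, and hence its set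
    -- of used parameters, is available.
    have hsat : s'.φ.Sat :=
      (H {Function.update ν κ n}
        (by rw [Set.singleton_subset_iff]; exact hsub c (Vertex.le_refl c) fun _ _ => rfl)
        (Set.singleton_nonempty _) (by rintro ν' rfl; simp)).sat
    let c' := c.child s' ⟨hfin, hstep, hsat⟩
    have hcc' : c < c' := (Vertex.isChild_child c _ _).lt
    refine ⟨v, c', Function.update ν κ n, huv, hve, H _ (hsub c' hcc'.1) ⟨_, fun _ _ => rfl⟩ ?_⟩
    intro ν' hν'
    rw [hν' ⟨c, hcc', hi, rfl⟩, Function.update_self]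
  · obtain ⟨v, huv, hve⟩ := Vertex.exists_child hue
    obtain ⟨s', hs', hsim⟩ := h.exists_classicStep huv hu
    let c' := c.child s' ⟨hfin, .classic hu hi s' hs', hsim.sat⟩
    exact ⟨v, c', ν, huv.lt, hve, .of_le (Vertex.isChild_child c _ _).le hsim⟩

/-- The representation of a vertex can be continued to the leaf. -/
theorem Represents.exists_leaf (hp : ∀ t ∈ p, t.IsTemplate)
    (hchoose : ∀ s anc, (∃ t ∈ p, t.l = s.l) → choose s anc ∈ p ∧ (choose s anc).l = s.l)
    (hfresh : ∀ u v : (compactTree p choose fresh).Vertex, u < v →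
      Instantiates p u.s → Instantiates p v.s → fresh u.s u.anc ≠ fresh v.s v.anc)
    {e u : (classicTree P).Vertex} (he : e.IsLeaf) (hue : u ≤ e)
    {c : (compactTree p choose fresh).Vertex} {ν : ℕ → ℕ} (h : Represents e u c ν) :
    ∃ (c' : (compactTree p choose fresh).Vertex) (ν' : ℕ → ℕ), Represents e e c' ν' := by
  -- A move may skip several vertices of the path, hence strong induction on the remaining distance.
  induction hn : e.anc.length - u.anc.length using Nat.strong_induction_on generalizing u c ν with
  | _ n ih =>
    by_cases hu : u = e
    · subst hu; exact ⟨c, ν, h⟩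
    · obtain ⟨v, c', ν', huv, hve, h'⟩ := h.exists_step hp hchoose hfresh he ⟨hue, hu⟩
      have h₁ := Vertex.length_lt_of_lt huv
      have h₂ := Vertex.length_le_of_le hve
      exact ih _ (by omega) hve h' rfl

end Compact

end CSE

theorem mainTheorem1 {V : CSE.Vocab} (P : CSE.Program V)
    (p : Set (CSE.Template P)) (hp : ∀ t ∈ p, t.IsTemplate)
    (choose : CSE.State P ℕ → List (CSE.State P ℕ) → CSE.Template P)
    (hchoose : ∀ s anc, (∃ t ∈ p, t.l = s.l) → choose s anc ∈ p ∧ (choose s anc).l = s.l)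
    (fresh : CSE.State P ℕ → List (CSE.State P ℕ) → ℕ)
    (hfresh : ∀ u v : (CSE.compactTree p choose fresh).Vertex, u < v →
      CSE.Instantiates p u.s → CSE.Instantiates p v.s → fresh u.s u.anc ≠ fresh v.s v.anc)
    (e : (CSE.classicTree P).Vertex) (he : e.IsLeaf) :
    ∃ e' : (CSE.compactTree p choose fresh).Vertex, e'.IsLeaf ∧
      ∃ ν : ℕ → ℕ, e.s.Equiv (e'.s.value ν) := by
  let c : (CSE.compactTree p choose fresh).Vertex := CSE.ExecTree.Vertex.root _
  -- The two initial states agree under every valuation, so the starting one is arbitrary.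
  have h : CSE.Represents e (CSE.ExecTree.Vertex.root _) c fun _ => 0 :=
    CSE.Simulates.init e ⟨fun _ => 0, fun _ _ => rfl⟩
  obtain ⟨e', ν, he'⟩ := h.exists_leaf hp hchoose hfresh he (CSE.ExecTree.Vertex.root_le e)
  exact ⟨e', he'.isLeaf hp he, ν, he'.equiv_value fun _ _ => rfl⟩
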